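/- For a finite tree $T$ let $N(T)$ be the number of its subtrees, i.e. of nonempty subgraphs of $T$ that are trees. For a locally finite tree $T$ and a vertex $v$ let $N(T-e,v)\in\{1,2,\dots\}\cup\{\infty\}$ be the number of trees that contain $v$ and are subgraphs of the graph $T-e$ obtained from $T$ by deleting the edge $e$, and let $M(T,v)=\min_{e\ni v}N(T-e,v)$, the minimum being over the edges $e$ incident with $v$ (and $M(T,v)=\infty$ if there is none). Put $f(T,v)=\log\bigl(1+\tfrac1{M(T,v)}\bigr)$, with $1/\infty=0$. Let $\mathcal{RT}$ be the set of locally finite rooted trees up to rooted isomorphism, with the $\sigma$-algebra generated by the isomorphism types of the closed balls of all radii around the root. A sequence of finite graphs $G_n$ is Benjamini–Schramm convergent with limit statistics $s$ if for every radius $r$ and every rooted graph $H$ the probability that the closed $r$-ball centred at a uniformly random vertex of $G_n$ is isomorphic to $H$ as a rooted graph converges to $s(H,r)$, and $s(\cdot,r)$ is a probability distribution (on isomorphism classes of rooted graphs) for every $r$. **Theorem.** Let $T_n$ be finite trees with $|T_n|\to\infty$ that are Benjamini–Schramm convergent with limit statistics $s$. Then there is exactly one probability measure $\sigma$ on $\mathcal{RT}$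 such that, for every $r$ and $H$, the closed $r$-ball around the root of a $\sigma$-random rooted tree is isomorphic to $H$ with probability $s(H,r)$. The function $f$ is $\sigma$-integrable, and $$\lim_{n\to\infty}\frac{\log N(T_n)}{|T_n|}=\mathbb{E}_\sigma[f]=\int_{\mathcal{RT}}\log\Bigl(1+\frac1{M(T,v)}\Bigr)\,d\sigma(T,v).$$ In particular, the limit exists and depends only on the Benjamini–Schramm limit of the sequence. -/

import Mathlib

open Filter Topology MeasureTheory

universe u

/-- A graph with a distinguished vertex (the root). -/
structure RootedGraph : Type (u + 1) where
  V : Type u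
  graph : SimpleGraph V
  root : V

/-- Two rooted graphs are isomorphic if some graph isomorphism maps root to root. -/
instance RootedGraph.isoSetoid : Setoid RootedGraph.{u} where
  r G H := ∃ φ : G.graph ≃g H.graph, φ G.root = H.root
  iseqv :=
    { refl := fun G => ⟨SimpleGraph.Iso.refl, rfl⟩
      symm := by
        rintro G H ⟨φ, h⟩
        refine ⟨φ.symm, ?_⟩
        rw [← h]
        exact φ.symm_apply_apply _
      trans := by
        rintro G H K ⟨φ, h⟩ ⟨ψ, k⟩
        exact ⟨ψ.comp φ, by simp [h, k]⟩ }

/-- Isomorphism classes of rooted graphs. -/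
def RGClass : Type (u + 1) := Quotient RootedGraph.isoSetoid.{u}

/-- The isomorphism class of the graph `G` rooted at `v`. -/
def rootedAt {V : Type u} (G : SimpleGraph V) (v : V) : RGClass.{u} :=
  Quotient.mk RootedGraph.isoSetoid ⟨V, G, v⟩

/-- The vertices at distance at most `r` from `v`. -/
def ballVerts {V : Type u} (G : SimpleGraph V) (v : V) (r : ℕ) : Set V :=
  {w | ∃ p : G.Walk v w, p.length ≤ r}

theorem ballVerts_map {V W : Type u} {G : SimpleGraph V} {H : SimpleGraph W} (φ : G ≃g H)
    {v w : V} {r : ℕ} (h : w ∈ ballVerts G v r) : φ w ∈ ballVerts H (φ v) r := by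
  obtain ⟨p, hp⟩ := h
  exact ⟨p.map φ.toHom, by simpa using hp⟩

/-- The closed `r`-ball centred at the root: the subgraph induced by the vertices at distance at
most `r` from the root, with the same root. -/
def RootedGraph.ball (r : ℕ) (G : RootedGraph.{u}) : RootedGraph.{u} where
  V := ballVerts G.graph G.root r
  graph := G.graph.induce (ballVerts G.graph G.root r)
  root := ⟨G.root, SimpleGraph.Walk.nil, Nat.zero_le r⟩

theorem RootedGraph.ball_equiv (r : ℕ) {G H : RootedGraph.{u}}
    (h : ∃ φ : G.graph ≃g H.graph, φ G.root = H.root) :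
    ∃ φ : (G.ball r).graph ≃g (H.ball r).graph, φ (G.ball r).root = (H.ball r).root := by
  obtain ⟨φ, h⟩ := h
  refine ⟨φ.induce (s := ballVerts G.graph G.root r) (t := ballVerts H.graph H.root r)
    ⟨fun w hw => h ▸ ballVerts_map φ hw, φ.injective.injOn, fun w hw => ?_⟩, ?_⟩
  · have := ballVerts_map φ.symm hw
    rw [← h] at this
    refine ⟨φ.symm w, ?_, φ.apply_symm_apply w⟩
    simpa using this
  · exact Subtype.ext h

/-- The closed `r`-ball centred at the root, on isomorphism classes. -/
def RGClass.ball (r : ℕ) : RGClass.{u} → RGClass.{u} :=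
  Quotient.map (RootedGraph.ball r) fun _ _ h => RootedGraph.ball_equiv r h

/-- The set of locally finite rooted trees, up to rooted isomorphism. -/
def LFRootedTree : Type (u + 1) :=
  {x : RGClass.{u} // ∃ (V : Type u) (G : SimpleGraph V) (v : V),
    G.IsTree ∧ (∀ w, (G.neighborSet w).Finite) ∧ x = rootedAt G v}

/-- The `σ`-algebra on rooted trees generated by the `r`-balls around the root for all `r`, that is
the Borel `σ`-algebra of the rooted distance (there are only countably many finite rooted graphs
up to isomorphism). -/
instance : MeasurableSpace LFRootedTree.{u} :=
  ⨆ r : ℕ, MeasurableSpace.comap (fun x : LFRootedTree.{u} => x.1.ball r) ⊤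

/-- `σ(H, r)` for the finite graph `G`: the probability that the `r`-ball centred at a uniformly
random vertex of `G` is isomorphic to `H`. -/
noncomputable def ballFreq {V : Type u} (G : SimpleGraph V) (r : ℕ) (H : RGClass.{u}) : ℝ :=
  ({v : V | (rootedAt G v).ball r = H}.ncard : ℝ) / (Nat.card V : ℝ)

/-- The sequence `G n` of finite graphs is Benjamini–Schramm convergent with limit statistics `s`:
for all `r` and `H` the ball frequencies converge to `s r H`, and `s r` is a probability
distribution for every `r`. (Ball frequencies vanish at infinite `H`, and hence so does `s r`.) -/
def BSConvergesTo {V : ℕ → Type u} (G : ∀ n, SimpleGraph (V n)) (s : ℕ → RGClass.{u} → ℝ) : Prop :=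
  (∀ r H, Tendsto (fun n => ballFreq (G n) r H) atTop (𝓝 (s r H))) ∧ ∀ r, HasSum (s r) 1

/-- The `r`-ball around the root of a `σ`-random rooted tree is distributed according to `s r`,
for every `r`. -/
def HasBallStatistics (σ : ProbabilityMeasure LFRootedTree.{u}) (s : ℕ → RGClass.{u} → ℝ) : Prop :=
  ∀ r H, (σ : Measure LFRootedTree.{u}).real {x | x.1.ball r = H} = s r H

/-- `N(T)`: the number of subtrees of `T`, i.e. of (nonempty) subgraphs that are trees. -/
noncomputable def numSubtrees {V : Type u} (T : SimpleGraph V) : ℕ :=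
  {S : T.Subgraph | S.coe.IsTree}.ncard

/-- `N(T, v)`: the number (possibly infinite) of subtrees of `T` that contain `v`. -/
noncomputable def numSubtreesAt {V : Type u} (T : SimpleGraph V) (v : V) : ℕ∞ :=
  {S : T.Subgraph | S.coe.IsTree ∧ v ∈ S.verts}.encard

/-- `M(T, v)`: the minimum of `N(T - e, v)` over all edges `e` incident with `v`. (If there is no
such edge, the value is `∞`.) -/
noncomputable def minSubtreesAt {V : Type u} (T : SimpleGraph V) (v : V) : ℕ∞ :=
  ⨅ e ∈ T.incidenceSet v, numSubtreesAt (T.deleteEdges {e}) v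

theorem numSubtreesAt_le {V W : Type u} {G : SimpleGraph V} {H : SimpleGraph W} (φ : G ≃g H)
    (v : V) : numSubtreesAt G v ≤ numSubtreesAt H (φ v) := by
  refine Set.encard_le_encard_of_injOn (f := fun S => S.map φ.toHom) ?_ ?_
  · rintro S ⟨hS, hv⟩
    refine ⟨?_, ⟨v, hv, rfl⟩⟩
    let ψ : S.coe ≃g (S.map φ.toHom).coe :=
      { toEquiv := Equiv.Set.image φ S.verts φ.injective
        map_rel_iff' := by
          rintro ⟨a, ha⟩ ⟨b, hb⟩
          constructor
          · rintro ⟨a', b', h, h1, h2⟩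
            have e1 : a' = a := φ.injective h1
            have e2 : b' = b := φ.injective h2
            subst e1 e2
            exact h
          · intro h
            exact ⟨a, b, h, rfl, rfl⟩ }
    exact ψ.isTree_iff.mp hS
  · intro S _ S' _ h
    have h' : S.map φ.toHom = S'.map φ.toHom := h
    refine SimpleGraph.Subgraph.ext ?_ ?_
    · exact φ.injective.image_injective (congrArg SimpleGraph.Subgraph.verts h')
    · have key : ∀ (A B : G.Subgraph), A.map φ.toHom = B.map φ.toHom →
          ∀ a b, A.Adj a b → B.Adj a b := by
        intro A B hAB a b hab
        have : (A.map φ.toHom).Adj (φ a) (φ b) := ⟨a, b, hab, rfl, rfl⟩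
        rw [hAB] at this
        obtain ⟨a', b', h, h1, h2⟩ := this
        have e1 : a' = a := φ.injective h1
        have e2 : b' = b := φ.injective h2
        subst e1 e2
        exact h
      funext a b
      exact propext ⟨key S S' h' a b, key S' S h'.symm a b⟩

theorem minSubtreesAt_le {V W : Type u} {G : SimpleGraph V} {H : SimpleGraph W} (φ : G ≃g H)
    (v : V) : minSubtreesAt G v ≤ minSubtreesAt H (φ v) := by
  refine le_iInf₂ fun e he => ?_
  obtain ⟨e, rfl⟩ : ∃ e', Sym2.map φ e' = e :=
    ⟨Sym2.map φ.symm e, by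
      induction e using Sym2.ind with
      | _ a b => simp⟩
  induction e using Sym2.ind with
  | _ a b =>
    have hab : s(a, b) ∈ G.incidenceSet v := by
      obtain ⟨h1, h2⟩ := he
      refine ⟨?_, ?_⟩
      · simpa [φ.map_adj_iff] using h1
      · simpa [Sym2.mem_iff, φ.injective.eq_iff] using h2
    refine (iInf₂_le _ hab).trans ?_
    let ψ : G.deleteEdges {s(a, b)} ≃g H.deleteEdges {Sym2.map φ s(a, b)} :=
      { toEquiv := φ.toEquiv
        map_rel_iff' := by
          intro x y
          simp [SimpleGraph.deleteEdges_adj, φ.injective.eq_iff, φ.map_adj_iff] }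
    exact numSubtreesAt_le ψ v

theorem minSubtreesAt_eq {V W : Type u} {G : SimpleGraph V} {H : SimpleGraph W} (φ : G ≃g H)
    (v : V) : minSubtreesAt G v = minSubtreesAt H (φ v) := by
  refine le_antisymm (minSubtreesAt_le φ v) ?_
  simpa using minSubtreesAt_le φ.symm (φ v)

/-- `M(T, v)` for an isomorphism class of rooted graphs. -/
noncomputable def RGClass.minSubtrees : RGClass.{u} → ℕ∞ :=
  Quotient.lift (fun G : RootedGraph.{u} => minSubtreesAt G.graph G.root) (by
    rintro G H ⟨φ, h⟩
    simp only [minSubtreesAt_eq φ G.root, h])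

/-- `f(T, v) = log (1 + 1 / M(T, v))`, with `1 / ∞ = 0`. -/
noncomputable def entropyFun (x : LFRootedTree.{u}) : ℝ :=
  Real.log (1 + ((x.1.minSubtrees : ENNReal)⁻¹).toReal)

/-!
In a tree rooted at `r`, every factor `1 + N(T - vp(v), v)`, with `p(v)` the parent of `v`, occurs
exactly once when `N(T, r)` and the numbers `N(T - vp(v), v)` are expanded as products over
children, so `log N(T, r)` is the sum of `log (1 + 1 / N(T - vp(v), v))` over `v ≠ r`. If `r`
maximizes `N(T, ·)`, the minimum `M(T, v)` is attained at the edge to the parent. Hence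
`log N(T) = ∑ v, f(T, v) + O(log |T|)`.

The cut-off `min M(T, v) (r + 1)` depends only on the `r`-ball around `v`: a connected set that
leaves the ball forces `r + 1` different balls within it. So `f` is a uniform limit of bounded
functions of balls, and their averages over `T_n` converge to integrals. The measure `σ` is the
image of the projective limit of the laws `s(·, r)` under gluing a coherent sequence of balls to a
tree.
-/

section ConnectedSets

variable {V : Type u} {G H : SimpleGraph V} {v w c : V} {S : Set V}

/-- The set of vertices that can be reached from `z` by walks of `G` within `S`. -/
def reachableWithin (G : SimpleGraph V) (S : Set V) (z : V) : Set V :=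
  {x | ∃ p : G.Walk z x, ∀ y ∈ p.support, y ∈ S}

theorem reachableWithin_subset (G : SimpleGraph V) (S : Set V) (z : V) :
    reachableWithin G S z ⊆ S := by
  rintro x ⟨p, hp⟩
  exact hp x p.end_mem_support

/-- The vertex sets of the connected subgraphs of `G` that contain `v`; in an acyclic graph they
are in bijection with the subtrees containing `v`. -/
def connectedSets (G : SimpleGraph V) (v : V) : Set (Set V) :=
  {S | v ∈ S ∧ S ⊆ reachableWithin G S v}

theorem singleton_mem_connectedSets (G : SimpleGraph V) (v : V) : {v} ∈ connectedSets G v :=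
  ⟨rfl, by rintro x rfl; exact ⟨.nil, by simp⟩⟩

theorem connectedSets_mono (h : G ≤ H) (v : V) : connectedSets G v ⊆ connectedSets H v := by
  rintro S ⟨hv, hS⟩
  refine ⟨hv, fun x hx => ?_⟩
  obtain ⟨p, hp⟩ := hS hx
  exact ⟨p.mapLe h, by simpa using hp⟩

theorem reachable_of_mem_connectedSets (hS : S ∈ connectedSets G v) {x : V} (hx : x ∈ S) :
    G.Reachable v x :=
  ⟨(hS.2 hx).choose⟩

theorem induce_connected_of_mem_connectedSets (hS : S ∈ connectedSets G v) :
    (G.induce S).Connected := by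
  have reachable (x : S) : (G.induce S).Reachable ⟨v, hS.1⟩ x := by
    obtain ⟨p, hp⟩ := hS.2 x.2
    exact ⟨p.induce S hp⟩
  exact { preconnected := fun x y => (reachable x).symm.trans (reachable y)
          nonempty := ⟨⟨v, hS.1⟩⟩ }

theorem verts_mem_connectedSets {K : G.Subgraph} (hK : K.coe.Preconnected) (hv : v ∈ K.verts) :
    K.verts ∈ connectedSets G v := by
  refine ⟨hv, fun x hx => ?_⟩
  obtain ⟨p⟩ := hK ⟨v, hv⟩ ⟨x, hx⟩
  refine ⟨p.map K.hom, fun y hy => ?_⟩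
  obtain ⟨z, -, rfl⟩ := List.mem_map.1 (SimpleGraph.Walk.support_map K.hom p ▸ hy)
  exact z.2

theorem connectedSets_eq_of_not_reachable (hHG : H ≤ G)
    (hH : ∀ a b, G.Adj a b → a ≠ v → b ≠ v → H.Adj a b) (hc : ¬ G.Reachable c v) :
    connectedSets H c = connectedSets G c := by
  classical
  refine (connectedSets_mono hHG c).antisymm ?_
  rintro S ⟨hcS, hS⟩
  refine ⟨hcS, fun x hx => ?_⟩
  obtain ⟨p, hp⟩ := hS hx
  have hv : v ∉ p.support := fun h => hc ⟨p.takeUntil v h⟩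
  refine ⟨p.transfer H fun e he => ?_, by rwa [SimpleGraph.Walk.support_transfer]⟩
  induction e using Sym2.ind with
  | _ a b =>
    refine hH a b (p.edges_subset_edgeSet he) ?_ ?_
    · rintro rfl
      exact hv (p.fst_mem_support_of_mem_edges he)
    · rintro rfl
      exact hv (p.snd_mem_support_of_mem_edges he)

theorem connectedSets_eq_singleton (h : ∀ w, ¬ G.Adj v w) : connectedSets G v = {{v}} := by
  refine Set.eq_singleton_iff_unique_mem.2 ⟨singleton_mem_connectedSets G v, ?_⟩
  rintro S ⟨hv, hS⟩
  refine Set.eq_singleton_iff_unique_mem.2 ⟨hv, fun x hx => ?_⟩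
  obtain ⟨_ | ⟨hadj, _⟩, -⟩ := hS hx
  · rfl
  · exact (h _ hadj).elim

theorem exists_walk_deleteEdges {a x : V} (p : G.Walk a x) (hp : ∀ y ∈ p.support, y ∈ S) :
    ∃ z, (z = a ∨ z = v ∨ z = w) ∧
      ∃ q : (G.deleteEdges {s(v, w)}).Walk z x, ∀ y ∈ q.support, y ∈ S := by
  induction p with
  | @nil a => exact ⟨a, .inl rfl, .nil, hp⟩
  | @cons a b x hab p ih =>
    obtain ⟨z, hz, q, hq⟩ := ih fun y hy => hp y (by simp [hy])
    rcases hz with rfl | hz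
    · by_cases he : s(a, z) = s(v, w)
      · have : z ∈ s(v, w) := he ▸ Sym2.mem_mk_right a z
        exact ⟨z, .inr (by simpa using this), q, hq⟩
      · refine ⟨a, .inl rfl, .cons (SimpleGraph.deleteEdges_adj.2 ⟨hab, he⟩) q, ?_⟩
        simpa using ⟨hp a (by simp), hq⟩
    · exact ⟨z, .inr hz, q, hq⟩

theorem reachableWithin_mem_connectedSets (hv : v ∈ S) :
    reachableWithin G S v ∈ connectedSets G v := by
  classical
  refine ⟨⟨.nil, by simpa⟩, ?_⟩
  rintro x ⟨p, hp⟩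
  exact ⟨p, fun y hy => ⟨p.takeUntil y hy, fun z hz =>
    hp z (p.support_takeUntil_subset_support hy hz)⟩⟩

theorem union_mem_connectedSets {A B : Set V} (hA : A ∈ connectedSets G v)
    (hB : B ∈ connectedSets G w) (hvw : G.Adj v w) : A ∪ B ∈ connectedSets G v := by
  refine ⟨.inl hA.1, ?_⟩
  rintro x (hx | hx)
  · obtain ⟨p, hp⟩ := hA.2 hx
    exact ⟨p, fun y hy => .inl (hp y hy)⟩
  · obtain ⟨p, hp⟩ := hB.2 hx
    refine ⟨.cons hvw p, ?_⟩
    simpa using ⟨.inl hA.1, fun y hy => .inr (hp y hy)⟩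

theorem connectedSets_eq_image2_union (hvw : G.Adj v w) :
    connectedSets G v = Set.image2 (· ∪ ·) (connectedSets (G.deleteEdges {s(v, w)}) v)
      (insert ∅ (connectedSets (G.deleteEdges {s(v, w)}) w)) := by
  set G' := G.deleteEdges {s(v, w)}
  have hle : G' ≤ G := G.deleteEdges_le _
  ext S
  constructor
  · rintro ⟨hv, hS⟩
    refine ⟨_, reachableWithin_mem_connectedSets hv, reachableWithin G' S w, ?_, ?_⟩
    · by_cases hw : w ∈ S
      · exact .inr (reachableWithin_mem_connectedSets hw)
      · exact .inl (Set.eq_empty_of_forall_notMem fun x ⟨p, hp⟩ => hw (hp w p.start_mem_support))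
    · refine (Set.union_subset (reachableWithin_subset ..) (reachableWithin_subset ..)).antisymm ?_
      intro x hx
      obtain ⟨p, hp⟩ := hS hx
      obtain ⟨z, rfl | rfl | rfl, hq⟩ := exists_walk_deleteEdges (v := v) (w := w) p hp
      exacts [.inl hq, .inl hq, .inr hq]
  · rintro ⟨A, hA, B, rfl | hB, rfl⟩
    · simpa using connectedSets_mono hle v hA
    · exact union_mem_connectedSets (connectedSets_mono hle v hA) (connectedSets_mono hle w hB) hvw

theorem injOn_union_connectedSets (h : ¬ G.Reachable v w) :
    (connectedSets G v ×ˢ insert ∅ (connectedSets G w)).InjOn fun P => P.1 ∪ P.2 := by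
  refine Set.LeftInvOn.injOn
    (f₁' := fun S => (S ∩ {x | G.Reachable v x}, S ∩ {x | G.Reachable w x})) ?_
  rintro ⟨A, B⟩ ⟨hA, hB⟩
  have hAv : A ⊆ {x | G.Reachable v x} := fun x hx => reachable_of_mem_connectedSets hA hx
  have hBw : B ⊆ {x | G.Reachable w x} := by
    rcases hB with rfl | hB
    · exact Set.empty_subset _
    · exact fun x hx => reachable_of_mem_connectedSets hB hx
  have hdisj : Disjoint {x | G.Reachable v x} {x | G.Reachable w x} :=
    Set.disjoint_left.2 fun x hv hw => h (hv.trans hw.symm)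
  have hBv := (hdisj.symm.mono_left hBw).inter_eq
  have hAw := (hdisj.mono_left hAv).inter_eq
  simp only [Set.union_inter_distrib_right, Set.inter_eq_left.2 hAv, Set.inter_eq_left.2 hBw, hBv,
    hAw, Set.union_empty, Set.empty_union]

theorem encard_connectedSets_eq_mul (hvw : G.Adj v w) (hb : G.IsBridge s(v, w)) :
    (connectedSets G v).encard = (connectedSets (G.deleteEdges {s(v, w)}) v).encard *
      (1 + (connectedSets (G.deleteEdges {s(v, w)}) w).encard) := by
  rw [connectedSets_eq_image2_union hvw, ← Set.image_prod,
    (injOn_union_connectedSets (SimpleGraph.isBridge_iff.1 hb)).encard_image, Set.encard_prod,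
    Set.encard_insert_of_notMem (fun h => h.1), add_comm 1]

end ConnectedSets

section Branches

variable {V : Type u} {G : SimpleGraph V} {v w c : V}

theorem subgraph_adj_of_preconnected (hG : G.IsAcyclic) {K : G.Subgraph} (hK : K.coe.Preconnected)
    {a b : V} (ha : a ∈ K.verts) (hb : b ∈ K.verts) (hab : G.Adj a b) : K.Adj a b := by
  obtain ⟨q, hq⟩ := (hK ⟨a, ha⟩ ⟨b, hb⟩).exists_isPath
  have hpath : q.map K.hom = hab.toWalk := congrArg Subtype.val <|
    (hG.subsingleton_path a b).elim ⟨_, hq.map K.hom_injective⟩ ⟨hab.toWalk, by simp [hab.ne]⟩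
  have hlen : q.length = 1 :=
    (SimpleGraph.Walk.length_map K.hom q).symm.trans (congrArg SimpleGraph.Walk.length hpath)
  exact SimpleGraph.Walk.adj_of_length_eq_one hlen

theorem injOn_verts_setOf_isTree (hG : G.IsAcyclic) :
    {K : G.Subgraph | K.coe.IsTree}.InjOn SimpleGraph.Subgraph.verts := by
  intro K hK L hL h
  refine SimpleGraph.Subgraph.ext h ?_
  ext a b
  constructor <;> intro hab
  · exact subgraph_adj_of_preconnected hG hL.connected.preconnected (h ▸ K.edge_vert hab)
      (h ▸ K.edge_vert hab.symm) hab.adj_sub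
  · exact subgraph_adj_of_preconnected hG hK.connected.preconnected (h ▸ L.edge_vert hab)
      (h ▸ L.edge_vert hab.symm) hab.adj_sub

theorem numSubtreesAt_eq_encard_connectedSets (hG : G.IsAcyclic) (v : V) :
    numSubtreesAt G v = (connectedSets G v).encard := by
  rw [numSubtreesAt,
    ← ((injOn_verts_setOf_isTree hG).mono fun _ h => h.1).encard_image]
  congr 1
  ext S
  constructor
  · rintro ⟨K, ⟨hK, hv⟩, rfl⟩
    exact verts_mem_connectedSets hK.connected.preconnected hv
  · intro hS
    have hconn := induce_connected_of_mem_connectedSets hS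
    exact ⟨(⊤ : G.Subgraph).induce S,
      ⟨⟨(SimpleGraph.connected_induce_iff.1 hconn).coe, hG.subgraph _⟩, hS.1⟩, rfl⟩

theorem one_le_numSubtreesAt (hG : G.IsAcyclic) (v : V) : 1 ≤ numSubtreesAt G v := by
  rw [numSubtreesAt_eq_encard_connectedSets hG, Set.one_le_encard_iff_nonempty]
  exact ⟨_, singleton_mem_connectedSets G v⟩

/-- `N(G - vw, v)`, the number of subtrees that contain `v` and avoid the edge `vw`. -/
noncomputable def branchCount (G : SimpleGraph V) (v w : V) : ℕ∞ :=
  numSubtreesAt (G.deleteEdges {s(v, w)}) v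

theorem one_le_branchCount (hG : G.IsAcyclic) (v w : V) : 1 ≤ branchCount G v w :=
  one_le_numSubtreesAt (hG.anti (G.deleteEdges_le _)) v

theorem branchCount_eq_encard (hG : G.IsAcyclic) (v w : V) :
    branchCount G v w = (connectedSets (G.deleteEdges {s(v, w)}) v).encard :=
  numSubtreesAt_eq_encard_connectedSets (hG.anti (G.deleteEdges_le _)) v

theorem minSubtreesAt_eq_iInf_branchCount (G : SimpleGraph V) (v : V) :
    minSubtreesAt G v = ⨅ w ∈ G.neighborSet v, branchCount G v w := by
  refine le_antisymm (le_iInf₂ fun w hw => iInf₂_le _ ⟨hw, Sym2.mem_mk_left v w⟩) (le_iInf₂ ?_)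
  rintro e ⟨he, hv⟩
  obtain ⟨w, rfl⟩ := Sym2.mem_iff_exists.1 hv
  exact iInf₂_le w he

theorem numSubtreesAt_eq_branchCount_mul (hG : G.IsAcyclic) (hvw : G.Adj v w) :
    numSubtreesAt G v = branchCount G v w * (1 + branchCount G w v) := by
  rw [numSubtreesAt_eq_encard_connectedSets hG, branchCount_eq_encard hG,
    branchCount_eq_encard hG, Sym2.eq_swap (a := w),
    encard_connectedSets_eq_mul hvw (SimpleGraph.isAcyclic_iff_forall_adj_isBridge.1 hG hvw)]

theorem branchCount_deleteEdges (hG : G.IsAcyclic) (hcv : G.Adj c v) (w : V) :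
    branchCount (G.deleteEdges {s(v, w)}) c v = branchCount G c v := by
  have hb := SimpleGraph.isAcyclic_iff_forall_adj_isBridge.1 hG hcv
  rw [branchCount_eq_encard hG, branchCount_eq_encard (hG.anti (G.deleteEdges_le _))]
  congr 1
  refine connectedSets_eq_of_not_reachable (v := v) ?_ ?_ (SimpleGraph.isBridge_iff.1 hb)
  · exact SimpleGraph.deleteEdges_mono (G.deleteEdges_le _)
  · intro a b hab ha hb
    simp_all [SimpleGraph.deleteEdges_adj]

theorem deleteEdges_adj_left_iff {d : V} :
    (G.deleteEdges {s(v, d)}).Adj v w ↔ G.Adj v w ∧ w ≠ d := by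
  simp only [SimpleGraph.deleteEdges_adj, Set.mem_singleton_iff, Sym2.congr_right, ne_eq]

theorem numSubtreesAt_eq_prod (hG : G.IsAcyclic) {s : Finset V} (hs : ∀ w, w ∈ s ↔ G.Adj v w) :
    numSubtreesAt G v = ∏ w ∈ s, (1 + branchCount G w v) := by
  classical
  induction s using Finset.induction_on generalizing G with
  | empty =>
    rw [numSubtreesAt_eq_encard_connectedSets hG, connectedSets_eq_singleton (by simpa using hs),
      Finset.prod_empty, Set.encard_singleton]
  | insert c s hc ih =>
    have hvc : G.Adj v c := (hs c).1 (Finset.mem_insert_self c s)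
    have hs' (w : V) : w ∈ s ↔ (G.deleteEdges {s(v, c)}).Adj v w := by
      rw [deleteEdges_adj_left_iff, ← hs w, Finset.mem_insert]
      grind
    rw [numSubtreesAt_eq_branchCount_mul hG hvc, branchCount, ih (hG.anti (G.deleteEdges_le _)) hs',
      Finset.prod_insert hc, mul_comm]
    refine congrArg _ (Finset.prod_congr rfl fun w hw => ?_)
    rw [branchCount_deleteEdges hG ((hs w).1 (Finset.mem_insert_of_mem hw)).symm]

theorem one_add_branchCount_le (hG : G.IsAcyclic) {d : V} (hw : G.Adj v w)
    (hwd : w ≠ d) : 1 + branchCount G w v ≤ branchCount G v d := by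
  have hG' : (G.deleteEdges {s(v, d)}).IsAcyclic := hG.anti (G.deleteEdges_le _)
  have hw' : (G.deleteEdges {s(v, d)}).Adj v w :=
    deleteEdges_adj_left_iff.2 ⟨hw, hwd⟩
  calc 1 + branchCount G w v = 1 + branchCount (G.deleteEdges {s(v, d)}) w v := by
        rw [branchCount_deleteEdges hG hw.symm]
    _ ≤ branchCount (G.deleteEdges {s(v, d)}) v w *
          (1 + branchCount (G.deleteEdges {s(v, d)}) w v) :=
        le_mul_of_one_le_left' (one_le_branchCount hG' v w)
    _ = branchCount G v d := (numSubtreesAt_eq_branchCount_mul hG' hw').symm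

end Branches

section FiniteTrees

variable {V : Type u} {T : SimpleGraph V} {r v : V} {p : V → V}

/-- `p` sends every vertex `v ≠ r` of the tree `T` rooted at `r` to its parent, the neighbour of
`v` on the way to `r`. -/
structure IsParentMap (T : SimpleGraph V) (r : V) (p : V → V) : Prop where
  adj_iff {v w : V} : T.Adj v w ↔ v ≠ r ∧ p v = w ∨ w ≠ r ∧ p w = v
  dist_eq {v : V} : v ≠ r → T.dist r v = T.dist r (p v) + 1

theorem IsParentMap.adj (hp : IsParentMap T r p) (hv : v ≠ r) : T.Adj v (p v) :=
  hp.adj_iff.2 (.inl ⟨hv, rfl⟩)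

theorem IsParentMap.parent_parent_ne (hp : IsParentMap T r p) (hv : v ≠ r) (hpv : p v ≠ r) :
    p (p v) ≠ v := by
  intro h
  have h1 := hp.dist_eq hv
  have h2 := hp.dist_eq hpv
  rw [h] at h2
  omega

theorem exists_isParentMap (hT : T.IsTree) (r : V) : ∃ p, IsParentMap T r p := by
  have exists_path (v : V) := (hT.connected r v).exists_path_of_dist
  choose q hq hlen using exists_path
  have penultimate_eq {v w : V} (hvw : T.Adj v w) (hd : T.dist r v = T.dist r w + 1) :
      (q v).penultimate = w := by
    have hpath : ((q w).concat hvw.symm).IsPath :=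
      SimpleGraph.Walk.isPath_of_length_eq_dist _ (by simp [hlen, hd])
    have := congrArg Subtype.val
      ((hT.isAcyclic.subsingleton_path r v).elim ⟨_, hq v⟩ ⟨_, hpath⟩)
    simpa using congrArg SimpleGraph.Walk.penultimate this
  have adj_penultimate {v : V} (hv : v ≠ r) : T.Adj v (q v).penultimate :=
    ((q v).adj_penultimate fun h => hv h.eq.symm).symm
  refine ⟨fun v => (q v).penultimate, ⟨fun hvw => ?_, ?_⟩, fun {v} hv => ?_⟩
  · rcases hT.dist_eq_dist_add_one_of_adj r hvw with hd | hd
    · exact .inl ⟨by rintro rfl; simp at hd, penultimate_eq hvw hd⟩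
    · exact .inr ⟨by rintro rfl; simp at hd, penultimate_eq hvw.symm hd⟩
  · rintro (⟨hv, rfl⟩ | ⟨hw, rfl⟩)
    exacts [adj_penultimate hv, (adj_penultimate hw).symm]
  · refine (hT.dist_eq_dist_add_one_of_adj r (adj_penultimate hv)).resolve_right fun hd => ?_
    have hle := SimpleGraph.dist_le (q v).dropLast
    have := (q v).length_dropLast_add_one fun h => hv h.eq.symm
    have := hlen v
    omega

theorem IsParentMap.branchCount_eq_prod_children [Fintype V] [DecidableEq V] (hT : T.IsAcyclic)
    (hp : IsParentMap T r p) (hv : v ≠ r) :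
    branchCount T v (p v) = ∏ c with c ≠ r ∧ p c = v, (1 + branchCount T c v) := by
  have mem_children (c : V) :
      c ∈ ({c | c ≠ r ∧ p c = v} : Finset V) ↔ (T.deleteEdges {s(v, p v)}).Adj v c := by
    rw [deleteEdges_adj_left_iff, hp.adj_iff, Finset.mem_filter_univ]
    have := hp.parent_parent_ne hv
    grind
  rw [branchCount, numSubtreesAt_eq_prod (hT.anti (T.deleteEdges_le _)) mem_children]
  refine Finset.prod_congr rfl fun c hc => ?_
  have hcv := (deleteEdges_adj_left_iff.1 ((mem_children c).1 hc)).1.symm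
  rw [branchCount_deleteEdges hT hcv]

theorem IsParentMap.numSubtreesAt_eq_prod_children [Fintype V] [DecidableEq V] (hT : T.IsAcyclic)
    (hp : IsParentMap T r p) :
    numSubtreesAt T r = ∏ c with c ≠ r ∧ p c = r, (1 + branchCount T c r) := by
  refine numSubtreesAt_eq_prod hT fun c => ?_
  rw [Finset.mem_filter_univ, hp.adj_iff]
  tauto

theorem IsParentMap.numSubtreesAt_mul_prod_branchCount [Fintype V] [DecidableEq V]
    (hT : T.IsAcyclic) (hp : IsParentMap T r p) :
    numSubtreesAt T r * ∏ v ∈ Finset.univ.erase r, branchCount T v (p v) =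
      ∏ v ∈ Finset.univ.erase r, (1 + branchCount T v (p v)) := by
  have children (v : V) :
      ∏ c with c ≠ r ∧ p c = v, (1 + branchCount T c v) =
        ∏ c ∈ Finset.univ.erase r with p c = v, (1 + branchCount T c (p c)) := by
    refine Finset.prod_congr (by ext; simp) fun c hc => ?_
    rw [(Finset.mem_filter.1 hc).2]
  rw [← Finset.prod_fiberwise _ p fun v => 1 + branchCount T v (p v),
    ← Finset.mul_prod_erase _ _ (Finset.mem_univ r), hp.numSubtreesAt_eq_prod_children hT, children]
  refine congrArg _ (Finset.prod_congr rfl fun v hv => ?_)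
  rw [hp.branchCount_eq_prod_children hT (Finset.ne_of_mem_erase hv), children]

theorem numSubtreesAt_ne_top [Finite V] (T : SimpleGraph V) (v : V) : numSubtreesAt T v ≠ ⊤ :=
  Set.encard_ne_top_iff.2 (Set.toFinite _)

theorem IsParentMap.branchCount_parent_le [Finite V] (hT : T.IsAcyclic) (hp : IsParentMap T r p)
    (hr : ∀ v, numSubtreesAt T v ≤ numSubtreesAt T r) (hv : v ≠ r) :
    branchCount T v (p v) ≤ branchCount T (p v) v := by
  induction hd : T.dist r v using Nat.strong_induction_on generalizing v with
  | _ d ih =>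
    have hadj := hp.adj hv
    by_cases hpv : p v = r
    · have hle := hr v
      rw [← hpv, numSubtreesAt_eq_branchCount_mul hT hadj,
        numSubtreesAt_eq_branchCount_mul hT hadj.symm] at hle
      lift branchCount T v (p v) to ℕ using numSubtreesAt_ne_top _ _ with m
      lift branchCount T (p v) v to ℕ using numSubtreesAt_ne_top _ _ with k
      norm_cast at hle ⊢
      linarith
    · have hpp := (hp.parent_parent_ne hv hpv).symm
      calc branchCount T v (p v) ≤ 1 + branchCount T v (p v) := le_add_self
        _ ≤ branchCount T (p v) (p (p v)) := one_add_branchCount_le hT hadj.symm hpp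
        _ ≤ branchCount T (p (p v)) (p v) := ih _ (by rw [← hd, hp.dist_eq hv]; omega) hpv rfl
        _ ≤ 1 + branchCount T (p (p v)) (p v) := le_add_self
        _ ≤ branchCount T (p v) v := one_add_branchCount_le hT (hp.adj hpv) hpp.symm

theorem IsParentMap.minSubtreesAt_eq [Finite V] (hT : T.IsAcyclic) (hp : IsParentMap T r p)
    (hr : ∀ v, numSubtreesAt T v ≤ numSubtreesAt T r) (hv : v ≠ r) :
    minSubtreesAt T v = branchCount T v (p v) := by
  rw [minSubtreesAt_eq_iInf_branchCount]
  refine le_antisymm (iInf₂_le _ (hp.adj hv)) (le_iInf₂ fun w _ => ?_)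
  by_cases hwp : w = p v
  · rw [hwp]
  · calc branchCount T v (p v) ≤ branchCount T (p v) v := hp.branchCount_parent_le hT hr hv
      _ ≤ 1 + branchCount T (p v) v := le_add_self
      _ ≤ branchCount T v w := one_add_branchCount_le hT (hp.adj hv) (Ne.symm hwp)

/-- The function `m ↦ log (1 + 1 / m)`, with `1 / ∞ = 0`, so that `f(T, v)` is its value at
`M(T, v)`. -/
noncomputable def logOneAddInv (m : ℕ∞) : ℝ :=
  Real.log (1 + ((m : ENNReal)⁻¹).toReal)

theorem logOneAddInv_natCast {n : ℕ} (hn : 1 ≤ n) :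
    logOneAddInv n = Real.log (1 + n) - Real.log n := by
  have : (n : ℝ) ≠ 0 := by positivity
  rw [logOneAddInv, ← Real.log_div (by positivity) this]
  congr 1
  rw [ENat.toENNReal_coe, ENNReal.toReal_inv, ENNReal.toReal_natCast]
  field_simp
  ring

theorem logOneAddInv_nonneg (m : ℕ∞) : 0 ≤ logOneAddInv m :=
  Real.log_nonneg (by simp)

theorem logOneAddInv_le_inv {m : ℕ∞} {k : ℕ} (hk : k ≠ 0) (h : k ≤ m) :
    logOneAddInv m ≤ (k : ℝ)⁻¹ := by
  have hinv : ((m : ENNReal)⁻¹).toReal ≤ (k : ℝ)⁻¹ := by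
    have hle : (m : ENNReal)⁻¹ ≤ (k : ENNReal)⁻¹ := ENNReal.inv_le_inv.2 (by exact_mod_cast h)
    simpa using ENNReal.toReal_mono (by simpa using hk) hle
  have hlog := Real.log_le_sub_one_of_pos (x := 1 + ((m : ENNReal)⁻¹).toReal) (by positivity)
  unfold logOneAddInv
  linarith

theorem logOneAddInv_le_one (m : ℕ∞) : logOneAddInv m ≤ 1 := by
  rcases eq_or_ne m 0 with rfl | h
  · simp [logOneAddInv]
  · simpa using logOneAddInv_le_inv one_ne_zero (by simpa using Order.one_le_iff_ne_zero.2 h)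

theorem abs_logOneAddInv_min_sub_le (m : ℕ∞) (r : ℕ) :
    |logOneAddInv (min m (r + 1)) - logOneAddInv m| ≤ ((r : ℝ) + 1)⁻¹ := by
  rcases le_total m (r + 1) with h | h
  · rw [min_eq_left h, sub_self, abs_zero]
    positivity
  · rw [min_eq_right h]
    have h1 := logOneAddInv_le_inv (m := r + 1) r.succ_ne_zero (by push_cast; exact le_rfl)
    have h2 := logOneAddInv_le_inv r.succ_ne_zero (m := m) (by exact_mod_cast h)
    push_cast at h1 h2
    exact abs_sub_le_of_nonneg_of_le (logOneAddInv_nonneg _) h1 (logOneAddInv_nonneg _) h2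

theorem IsParentMap.log_numSubtreesAt_eq_sum [Fintype V] [DecidableEq V] (hT : T.IsAcyclic)
    (hp : IsParentMap T r p) :
    Real.log (numSubtreesAt T r).toNat =
      ∑ v ∈ Finset.univ.erase r, logOneAddInv (branchCount T v (p v)) := by
  obtain ⟨b, hb⟩ : ∃ b : V → ℕ, ∀ v, branchCount T v (p v) = b v :=
    ⟨_, fun v => (ENat.natCast_toNat (numSubtreesAt_ne_top _ _)).symm⟩
  obtain ⟨m, hm⟩ : ∃ m : ℕ, numSubtreesAt T r = m :=
    ⟨_, (ENat.natCast_toNat (numSubtreesAt_ne_top _ _)).symm⟩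
  have hb1 (v : V) : 1 ≤ b v := by exact_mod_cast hb v ▸ one_le_branchCount hT v (p v)
  have hm1 : 1 ≤ m := by exact_mod_cast hm ▸ one_le_numSubtreesAt hT r
  have hprod : (m : ℝ) * ∏ v ∈ Finset.univ.erase r, (b v : ℝ) =
      ∏ v ∈ Finset.univ.erase r, (1 + (b v : ℝ)) := by
    have := hp.numSubtreesAt_mul_prod_branchCount hT
    simp only [hb, hm] at this
    exact_mod_cast this
  have hb0 (v : V) : (b v : ℝ) ≠ 0 := by exact_mod_cast Nat.one_le_iff_ne_zero.1 (hb1 v)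
  have hlog := congrArg Real.log hprod
  rw [Real.log_mul (by positivity) (Finset.prod_ne_zero_iff.2 fun v _ => hb0 v),
    Real.log_prod fun v _ => hb0 v, Real.log_prod fun v _ => by positivity] at hlog
  simp only [hb, hm, ENat.toNat_natCast, logOneAddInv_natCast (hb1 _), Finset.sum_sub_distrib]
  linarith

theorem numSubtreesAt_le_numSubtrees [Finite V] (T : SimpleGraph V) (v : V) :
    numSubtreesAt T v ≤ numSubtrees T := by
  rw [numSubtrees, (Set.toFinite _).cast_ncard_eq]
  exact Set.encard_le_encard fun K hK => hK.1

theorem numSubtrees_le_card_mul [Finite V] {n : ℕ∞} (hn : ∀ v, numSubtreesAt T v ≤ n) :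
    numSubtrees T ≤ Nat.card V * n := by
  have := Fintype.ofFinite V
  have hsub : {K : T.Subgraph | K.coe.IsTree} ⊆
      ⋃ v, {K : T.Subgraph | K.coe.IsTree ∧ v ∈ K.verts} := by
    intro K hK
    obtain ⟨v⟩ := (Set.mem_ofPred.1 hK).connected.nonempty
    exact Set.mem_iUnion.2 ⟨v.1, hK, v.2⟩
  rw [numSubtrees, (Set.toFinite _).cast_ncard_eq]
  calc {K : T.Subgraph | K.coe.IsTree}.encard
      ≤ (⋃ v, {K : T.Subgraph | K.coe.IsTree ∧ v ∈ K.verts}).encard := Set.encard_le_encard hsub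
    _ ≤ ∑ v, numSubtreesAt T v := Set.encard_iUnion_le_of_fintype _
    _ ≤ ∑ _v : V, n := Finset.sum_le_sum fun v _ => hn v
    _ = Nat.card V * n := by simp [Nat.card_eq_fintype_card]

theorem abs_log_numSubtrees_sub_log_le [Finite V] (hT : T.IsAcyclic)
    (hr : ∀ v, numSubtreesAt T v ≤ numSubtreesAt T r) :
    |Real.log (numSubtrees T) - Real.log (numSubtreesAt T r).toNat| ≤ Real.log (Nat.card V) := by
  have := Nonempty.intro r
  have hlow := numSubtreesAt_le_numSubtrees T r
  have hupp := numSubtrees_le_card_mul hr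
  have hpos := one_le_numSubtreesAt hT r
  obtain ⟨m, hm⟩ : ∃ m : ℕ, numSubtreesAt T r = m :=
    ⟨_, (ENat.natCast_toNat (numSubtreesAt_ne_top _ _)).symm⟩
  rw [hm] at hlow hupp hpos ⊢
  norm_cast at hlow hupp hpos
  have hlog_low : Real.log m ≤ Real.log (numSubtrees T) :=
    Real.log_le_log (by exact_mod_cast hpos) (by exact_mod_cast hlow)
  have hlog_upp : Real.log (numSubtrees T) ≤ Real.log (Nat.card V) + Real.log m := by
    rw [← Real.log_mul (by exact_mod_cast Nat.card_pos.ne') (by positivity)]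
    exact Real.log_le_log (by exact_mod_cast hpos.trans hlow) (by exact_mod_cast hupp)
  rw [ENat.toNat_natCast, abs_of_nonneg (by linarith)]
  linarith

theorem abs_log_numSubtrees_sub_sum_le [Fintype V] (hT : T.IsTree) :
    |Real.log (numSubtrees T) - ∑ v, logOneAddInv (minSubtreesAt T v)| ≤
      Real.log (Nat.card V) + 1 := by
  classical
  have := hT.connected.nonempty
  obtain ⟨r, hr⟩ := Finite.exists_max (numSubtreesAt T)
  obtain ⟨p, hp⟩ := exists_isParentMap hT r
  have hsum : ∑ v, logOneAddInv (minSubtreesAt T v) =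
      logOneAddInv (minSubtreesAt T r) + Real.log (numSubtreesAt T r).toNat := by
    rw [← Finset.add_sum_erase _ _ (Finset.mem_univ r), hp.log_numSubtreesAt_eq_sum hT.isAcyclic]
    congr 1
    refine Finset.sum_congr rfl fun v hv => ?_
    rw [hp.minSubtreesAt_eq hT.isAcyclic hr (Finset.ne_of_mem_erase hv)]
  have hmain := abs_le.1 (abs_log_numSubtrees_sub_log_le hT.isAcyclic hr)
  have hnonneg := logOneAddInv_nonneg (minSubtreesAt T r)
  have hle := logOneAddInv_le_one (minSubtreesAt T r)
  rw [hsum, abs_le]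
  constructor <;> linarith

end FiniteTrees

section Balls

variable {V W : Type u} {G : SimpleGraph V} {H : SimpleGraph W} {v x y : V} {B S : Set V} {r : ℕ}

theorem root_mem_ballVerts (G : SimpleGraph V) (v : V) (r : ℕ) : v ∈ ballVerts G v r :=
  ⟨.nil, Nat.zero_le r⟩

theorem ballVerts_monotone (G : SimpleGraph V) (v : V) : Monotone (ballVerts G v) := by
  rintro r r' h x ⟨p, hp⟩
  exact ⟨p, hp.trans h⟩

theorem ballVerts_zero (G : SimpleGraph V) (v : V) : ballVerts G v 0 = {v} := by
  refine Set.eq_singleton_iff_unique_mem.2 ⟨root_mem_ballVerts G v 0, ?_⟩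
  rintro x ⟨p, hp⟩
  exact (SimpleGraph.Walk.eq_of_length_eq_zero (Nat.le_zero.1 hp)).symm

theorem mapsTo_ballVerts (f : G →g H) : Set.MapsTo f (ballVerts G v r) (ballVerts H (f v) r) := by
  rintro x ⟨p, hp⟩
  exact ⟨p.map f, by rwa [SimpleGraph.Walk.length_map]⟩

theorem mem_ballVerts_succ_of_adj (hx : x ∈ ballVerts G v r) (h : G.Adj x y) :
    y ∈ ballVerts G v (r + 1) := by
  obtain ⟨p, hp⟩ := hx
  exact ⟨p.concat h, by simpa using hp⟩

theorem ballVerts_succ (G : SimpleGraph V) (v : V) (r : ℕ) :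
    ballVerts G v (r + 1) = ballVerts G v r ∪ ⋃ x ∈ ballVerts G v r, G.neighborSet x := by
  refine Set.Subset.antisymm ?_ (Set.union_subset (ballVerts_monotone G v r.le_succ)
    (Set.iUnion₂_subset fun x hx y hxy => mem_ballVerts_succ_of_adj hx hxy))
  rintro x ⟨p, hp⟩
  by_cases hnil : p.Nil
  · exact .inl ⟨p, by simp [SimpleGraph.Walk.length_eq_zero_iff.2 hnil]⟩
  · have hlen := p.length_dropLast_add_one hnil
    exact .inr (Set.mem_biUnion ⟨p.dropLast, by omega⟩ (p.adj_penultimate hnil))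

theorem ballVerts_mem_connectedSets (G : SimpleGraph V) (v : V) (r : ℕ) :
    ballVerts G v r ∈ connectedSets G v := by
  classical
  refine ⟨root_mem_ballVerts G v r, ?_⟩
  rintro x ⟨p, hp⟩
  exact ⟨p, fun y hy => ⟨p.takeUntil y hy, (p.length_takeUntil_le_length hy).trans hp⟩⟩

theorem ballVerts_ssubset_succ (hx : G.Reachable v x) (hxr : x ∉ ballVerts G v r) :
    ballVerts G v r ⊂ ballVerts G v (r + 1) := by
  refine (ballVerts_monotone G v r.le_succ).ssubset_of_ne fun heq => hxr ?_
  have step {a b : V} (ha : a ∈ ballVerts G v r) (hab : G.Adj a b) : b ∈ ballVerts G v r :=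
    heq ▸ mem_ballVerts_succ_of_adj ha hab
  have reach {a b : V} (p : G.Walk a b) (ha : a ∈ ballVerts G v r) : b ∈ ballVerts G v r := by
    induction p with
    | nil => exact ha
    | cons h _ ih => exact ih (step ha h)
  exact hx.elim fun p => reach p (root_mem_ballVerts G v r)

theorem strictMonoOn_ballVerts (hx : G.Reachable v x) (hxr : x ∉ ballVerts G v r) :
    StrictMonoOn (ballVerts G v) (Set.Iic r) := by
  refine strictMonoOn_of_lt_add_one Set.ordConnected_Iic fun k _ hk _ =>
    ballVerts_ssubset_succ hx fun hxk => hxr (ballVerts_monotone G v hk hxk)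

theorem image_connectedSets_induce (hv : v ∈ B) :
    Set.image Subtype.val '' connectedSets (G.induce B) ⟨v, hv⟩ =
      {S ∈ connectedSets G v | S ⊆ B} := by
  ext S
  constructor
  · rintro ⟨S, hS, rfl⟩
    refine ⟨⟨⟨_, hS.1, rfl⟩, ?_⟩, Subtype.coe_image_subset B S⟩
    rintro _ ⟨x, hx, rfl⟩
    obtain ⟨p, hp⟩ := hS.2 hx
    refine ⟨p.map (SimpleGraph.Embedding.induce B).toHom, fun y hy => ?_⟩
    obtain ⟨z, hz, rfl⟩ := List.mem_map.1
      (SimpleGraph.Walk.support_map (SimpleGraph.Embedding.induce B).toHom p ▸ hy)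
    exact ⟨z, hp z hz, rfl⟩
  · rintro ⟨hS, hSB⟩
    refine ⟨Subtype.val ⁻¹' S, ⟨hS.1, ?_⟩, by simpa using hSB⟩
    rintro ⟨x, hxB⟩ hx
    obtain ⟨p, hp⟩ := hS.2 hx
    refine ⟨p.induce B fun y hy => hSB (hp y hy), ?_⟩
    rintro ⟨y, hy⟩ h
    exact hp y (by simpa using h)

theorem encard_connectedSets_induce (hv : v ∈ B) :
    (connectedSets (G.induce B) ⟨v, hv⟩).encard = {S ∈ connectedSets G v | S ⊆ B}.encard := by
  rw [← image_connectedSets_induce hv, Subtype.val_injective.image_injective.encard_image]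

/-- If some connected set through `v` is not contained in `B`, the balls of radius at most `r`
around `v` are `r + 1` different connected sets within `B`. -/
theorem min_encard_connectedSets_induce (hv : v ∈ B) (hB : ballVerts G v r ⊆ B) :
    min (connectedSets (G.induce B) ⟨v, hv⟩).encard (r + 1) =
      min (connectedSets G v).encard (r + 1) := by
  rw [encard_connectedSets_induce]
  by_cases h : ∀ S ∈ connectedSets G v, S ⊆ B
  · rw [Set.sep_eq_self_iff_mem_true.2 h]
  · push Not at h
    obtain ⟨S, hS, hSB⟩ := h
    obtain ⟨x, hx, hxB⟩ := Set.not_subset.1 hSB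
    have many : (r + 1 : ℕ∞) ≤ {S ∈ connectedSets G v | S ⊆ B}.encard :=
      calc (r + 1 : ℕ∞) = (Set.Iic r).encard := by
            rw [← Finset.coe_Iic, Set.encard_coe_eq_coe_finsetCard, Nat.card_Iic, Nat.cast_add_one]
        _ ≤ {S ∈ connectedSets G v | S ⊆ B}.encard := Set.encard_le_encard_of_injOn
            (fun k hk => ⟨ballVerts_mem_connectedSets G v k, (ballVerts_monotone G v hk).trans hB⟩)
            (strictMonoOn_ballVerts (reachable_of_mem_connectedSets hS hx)
              fun hxr => hxB (hB hxr)).injOn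
    rw [min_eq_right many, min_eq_right (many.trans (Set.encard_le_encard (Set.sep_subset _ _)))]

theorem induce_deleteEdges_singleton {a b : B} :
    (G.induce B).deleteEdges {s(a, b)} = (G.deleteEdges {s(a.1, b.1)}).induce B := by
  ext x y
  simp [SimpleGraph.deleteEdges_adj, Subtype.ext_iff]

theorem min_branchCount_induce (hG : G.IsAcyclic) (hv : v ∈ B) (hB : ballVerts G v r ⊆ B)
    (w : B) :
    min (branchCount (G.induce B) ⟨v, hv⟩ w) (r + 1) = min (branchCount G v w) (r + 1) := by
  rw [branchCount_eq_encard hG, branchCount_eq_encard (hG.induce B), induce_deleteEdges_singleton]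
  exact min_encard_connectedSets_induce hv
    (subset_trans (mapsTo_ballVerts (.ofLE (G.deleteEdges_le _))) hB)

theorem min_minSubtreesAt_induce (hG : G.IsAcyclic) (hv : v ∈ B) (hB : ballVerts G v r ⊆ B)
    (hN : G.neighborSet v ⊆ B) :
    min (minSubtreesAt (G.induce B) ⟨v, hv⟩) (r + 1) = min (minSubtreesAt G v) (r + 1) := by
  simp only [minSubtreesAt_eq_iInf_branchCount]
  refine eq_of_forall_le_iff fun c => ?_
  simp only [le_min_iff, le_iInf_iff]
  refine and_congr_left fun hc => ?_
  have key (w : B) : c ≤ branchCount (G.induce B) ⟨v, hv⟩ w ↔ c ≤ branchCount G v w := by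
    simpa [hc] using congrArg (c ≤ ·) (min_branchCount_induce hG hv hB w)
  exact ⟨fun h w hw => (key ⟨w, hN hw⟩).1 (h ⟨w, hN hw⟩ hw), fun h w hw => (key w).2 (h w hw)⟩

theorem min_minSubtrees_ball (hG : G.IsAcyclic) (v : V) (hr : 1 ≤ r) :
    min ((rootedAt G v).ball r).minSubtrees (r + 1) = min (rootedAt G v).minSubtrees (r + 1) :=
  min_minSubtreesAt_induce hG (root_mem_ballVerts G v r) subset_rfl fun _ hw =>
    ballVerts_monotone G v hr (mem_ballVerts_succ_of_adj (root_mem_ballVerts G v 0) hw)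

theorem image_ballVerts (f : G ↪g H) {R : ℕ}
    (h : ∀ r < R, ∀ x ∈ ballVerts G v r, H.neighborSet (f x) ⊆ Set.range f) :
    f '' ballVerts G v R = ballVerts H (f v) R := by
  induction R with
  | zero => simp only [ballVerts_zero, Set.image_singleton]
  | succ R ih =>
    have nbhd : ∀ x ∈ ballVerts G v R, f '' G.neighborSet x = H.neighborSet (f x) := by
      intro x hx
      have hpre : G.neighborSet x = f ⁻¹' H.neighborSet (f x) := by ext; simp
      rw [hpre, Set.image_preimage_eq_of_subset (h R R.lt_succ_self x hx)]
    rw [ballVerts_succ, ballVerts_succ, Set.image_union, Set.image_iUnion₂,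
      ← ih fun r hr => h r (hr.trans R.lt_succ_self), Set.biUnion_image, Set.iUnion₂_congr nbhd]

theorem image_ballVerts_of_subset_range (f : G ↪g H) {n : ℕ}
    (h : ballVerts H (f v) n ⊆ Set.range f) (hr : r ≤ n) :
    f '' ballVerts G v r = ballVerts H (f v) r :=
  image_ballVerts f fun _ hk _ hx _ hy =>
    h (ballVerts_monotone H (f v) (hk.trans_le hr)
      (mem_ballVerts_succ_of_adj (mapsTo_ballVerts f.toHom hx) hy))

theorem ball_rootedAt_eq_of_image (f : G ↪g H) (h : f '' ballVerts G v r = ballVerts H (f v) r) :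
    (rootedAt G v).ball r = (rootedAt H (f v)).ball r :=
  Quotient.sound ⟨{ toEquiv := (h ▸ f.injective.injOn.bijOn_image : Set.BijOn f _ _).equiv f
                    map_rel_iff' := f.map_adj_iff }, rfl⟩

theorem RGClass.ball_ball {r r' : ℕ} (h : r ≤ r') (x : RGClass.{u}) :
    (x.ball r').ball r = x.ball r := by
  obtain ⟨V, G, v⟩ := x
  exact ball_rootedAt_eq_of_image (SimpleGraph.Embedding.induce (ballVerts G v r'))
    (image_ballVerts_of_subset_range _ (Subtype.range_coe (s := ballVerts G v r')).superset h)

end Balls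

section LimitTree

theorem exists_directLimit_embedding {ι : Type*} [Preorder ι] [IsDirectedOrder ι] {X : ι → Type*}
    (G : ∀ i, SimpleGraph (X i)) (f : ∀ i j, i ≤ j → G i ↪g G j) [DirectedSystem X (f · · ·)] :
    ∃ L : SimpleGraph (DirectLimit X f), ∃ g : ∀ i, G i ↪g L,
      (∀ i j (h : i ≤ j) x, g j (f i j h x) = g i x) ∧ ∀ y, ∃ i x, g i x = y := by
  let adj : DirectLimit X f → DirectLimit X f → Prop :=
    DirectLimit.lift₂ f f (fun i => (G i).Adj) fun i j h x y => propext (f i j h).map_adj_iff.symm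
  have adj_mk (i) (x y : X i) : adj ⟦⟨i, x⟩⟧ ⟦⟨i, y⟩⟧ = (G i).Adj x y := DirectLimit.lift₂_def ..
  let L : SimpleGraph (DirectLimit X f) :=
    { Adj := adj
      symm := ⟨fun x y => by
        induction x, y using DirectLimit.induction₂ with
        | ih i x y => rw [adj_mk, adj_mk]; exact fun h => h.symm⟩
      loopless := ⟨fun x => by
        induction x using DirectLimit.induction with
        | ih i x => rw [adj_mk]; exact (G i).irrefl⟩ }
  let g (i : ι) : G i ↪g L :=
    { toFun := fun x => ⟦⟨i, x⟩⟧
      inj' := DirectLimit.mk_injective f (fun i j h => (f i j h).injective) i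
      map_rel_iff' := @fun x y => iff_of_eq (adj_mk i x y) }
  exact ⟨L, g, fun i j h x => DirectLimit.mk_apply i j x h,
    fun y => let ⟨i, x, h⟩ := DirectLimit.exists_eq_mk f y; ⟨i, x, h.symm⟩⟩

theorem exists_limit_of_embedding_succ {X : ℕ → Type u} {G : ∀ n, SimpleGraph (X n)}
    (f : ∀ n, G n ↪g G (n + 1)) :
    ∃ (Y : Type u) (L : SimpleGraph Y) (g : ∀ n, G n ↪g L),
      (∀ n x, g (n + 1) (f n x) = g n x) ∧ ∀ y, ∃ n x, g n x = y := by
  let t (n m : ℕ) (h : n ≤ m) : G n ↪g G m :=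
    Nat.leRecOn (C := fun k => G n ↪g G k) h (fun {k} e => (f k).comp e) SimpleGraph.Embedding.refl
  have t_succ {n m : ℕ} (h : n ≤ m) (x : X n) :
      t n (m + 1) (h.trans m.le_succ) x = f m (t n m h x) :=
    DFunLike.congr_fun (Nat.leRecOn_succ (C := fun k => G n ↪g G k) h _) x
  have t_self (n : ℕ) (x : X n) : t n n le_rfl x = x :=
    DFunLike.congr_fun (Nat.leRecOn_self (C := fun k => G n ↪g G k) _) x
  have : DirectedSystem X (t · · ·) :=
    { map_self := t_self
      map_map := fun k j i hij hjk x => by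
        induction k, hjk using Nat.le_induction with
        | base => exact t_self j _
        | succ k hjk ih => rw [t_succ hjk, ih, t_succ] }
  obtain ⟨L, g, hg, hsurj⟩ := exists_directLimit_embedding G t
  refine ⟨_, L, g, fun n x => ?_, hsurj⟩
  rw [← hg n (n + 1) n.le_succ, t_succ le_rfl, t_self]

theorem image_ballVerts_limit {X : ℕ → Type u} {G : ∀ n, SimpleGraph (X n)} {v : ∀ n, X n}
    {f : ∀ n, G n ↪g G (n + 1)} (hf : ∀ n, f n (v n) = v (n + 1))
    (hrange : ∀ n, ballVerts (G (n + 1)) (v (n + 1)) n ⊆ Set.range (f n))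
    {Y : Type u} {L : SimpleGraph Y} {g : ∀ n, G n ↪g L} (hg : ∀ n x, g (n + 1) (f n x) = g n x)
    (hsurj : ∀ y, ∃ n x, g n x = y) (n : ℕ) :
    g n '' ballVerts (G n) (v n) n = ballVerts L (g n (v n)) n := by
  have image_eq {r n m : ℕ} (hr : r ≤ n) (hnm : n ≤ m) :
      g m '' ballVerts (G m) (v m) r = g n '' ballVerts (G n) (v n) r := by
    induction m, hnm using Nat.le_induction with
    | base => rfl
    | succ m hnm ih =>
      have step := image_ballVerts_of_subset_range (f m) (by rw [hf]; exact hrange m) (hr.trans hnm)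
      rw [← ih, ← hf, ← step, Set.image_image]
      simp only [hg]
  have range_mono : Monotone fun n => Set.range (g n) :=
    monotone_nat_of_le_succ fun n => by rintro _ ⟨x, rfl⟩; exact ⟨f n x, hg n x⟩
  refine image_ballVerts (g n) fun r hr x hx y hy => ?_
  obtain ⟨m, hnm, b, rfl⟩ : ∃ m, n ≤ m ∧ y ∈ Set.range (g m) := by
    obtain ⟨k, hk⟩ := hsurj y
    exact ⟨max n k, le_max_left n k, range_mono (le_max_right n k) hk⟩
  obtain ⟨x', hx', hxx'⟩ : g n x ∈ g m '' ballVerts (G m) (v m) r :=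
    image_eq hr.le hnm ▸ Set.mem_image_of_mem _ hx
  rw [← hxx', SimpleGraph.mem_neighborSet, (g m).map_adj_iff] at hy
  exact Set.image_subset_range _ _ <|
    image_eq hr hnm ▸ Set.mem_image_of_mem (g m) (mem_ballVerts_succ_of_adj hx' hy)

theorem exists_embedding_of_ball_eq {K K' : RootedGraph.{u}} {n : ℕ}
    (h : RGClass.ball n (Quotient.mk _ K') = Quotient.mk _ K) :
    ∃ f : K.graph ↪g K'.graph, f K.root = K'.root ∧
      Set.range f = ballVerts K'.graph K'.root n := by
  obtain ⟨φ, hφ⟩ : ∃ φ : K.graph ≃g (K'.ball n).graph, φ K.root = (K'.ball n).root :=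
    Quotient.exact h.symm
  refine ⟨(SimpleGraph.Embedding.induce (ballVerts K'.graph K'.root n)).comp φ.toEmbedding,
    congrArg Subtype.val hφ, ?_⟩
  exact (φ.surjective.range_comp Subtype.val).trans Subtype.range_coe

/-- The class of balls of radius `r` in finite trees, which carry the limit statistics. -/
def IsFiniteTreeBall (r : ℕ) (H : RGClass.{u}) : Prop :=
  ∃ (V : Type u) (T : SimpleGraph V) (v : V), Finite V ∧ T.IsTree ∧ H = (rootedAt T v).ball r

namespace IsFiniteTreeBall

variable {r : ℕ} {H : RGClass.{u}}

theorem ball_eq (h : IsFiniteTreeBall r H) : H.ball r = H := by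
  obtain ⟨V, T, v, -, -, rfl⟩ := h
  exact RGClass.ball_ball le_rfl _

theorem exists_rep (h : IsFiniteTreeBall r H) :
    ∃ K : RootedGraph.{u}, Finite K.V ∧ K.graph.IsTree ∧ Quotient.mk _ K = H := by
  obtain ⟨V, T, v, _, hT, rfl⟩ := h
  exact ⟨RootedGraph.ball r ⟨V, T, v⟩, inferInstanceAs (Finite (ballVerts T v r)),
    ⟨induce_connected_of_mem_connectedSets (ballVerts_mem_connectedSets T v r),
      hT.isAcyclic.induce _⟩, rfl⟩

variable {V : Type u} {G : SimpleGraph V} {v : V}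

theorem exists_iso (h : IsFiniteTreeBall r ((rootedAt G v).ball r)) :
    ∃ K : RootedGraph.{u}, Finite K.V ∧ K.graph.IsTree ∧
      Nonempty (G.induce (ballVerts G v r) ≃g K.graph) := by
  obtain ⟨K, hfin, hK, hKG⟩ := h.exists_rep
  obtain ⟨φ, -⟩ := Quotient.exact hKG.symm
  exact ⟨K, hfin, hK, ⟨φ⟩⟩

theorem finite_ballVerts (h : IsFiniteTreeBall r ((rootedAt G v).ball r)) :
    (ballVerts G v r).Finite := by
  obtain ⟨K, _, -, ⟨φ⟩⟩ := h.exists_iso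
  exact Set.finite_coe_iff.1 (Finite.of_equiv K.V φ.symm.toEquiv)

theorem isAcyclic_induce (h : IsFiniteTreeBall r ((rootedAt G v).ball r)) :
    (G.induce (ballVerts G v r)).IsAcyclic := by
  obtain ⟨K, -, hK, ⟨φ⟩⟩ := h.exists_iso
  exact φ.isAcyclic_iff.2 hK.isAcyclic

end IsFiniteTreeBall

section LocalToGlobal

variable {V : Type u} {G : SimpleGraph V} (v : V)

theorem exists_mem_ballVerts (hG : G.Preconnected) (x : V) : ∃ n, x ∈ ballVerts G v n :=
  (hG v x).elim fun p => ⟨p.length, p, le_rfl⟩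

theorem isAcyclic_of_forall_induce_ballVerts (hG : G.Preconnected)
    (h : ∀ n, (G.induce (ballVerts G v n)).IsAcyclic) : G.IsAcyclic := by
  intro x c hc
  choose n hn using exists_mem_ballVerts v hG
  obtain ⟨N, hN⟩ := (c.support.map n).toFinset.exists_le
  have hsupp : ∀ y ∈ c.support, y ∈ ballVerts G v N := fun y hy =>
    ballVerts_monotone G v (hN (n y) (by simpa using ⟨y, hy, rfl⟩)) (hn y)
  rw [← SimpleGraph.Walk.map_induce c hsupp] at hc
  exact h N (c.induce _ hsupp) hc.of_map

theorem finite_neighborSet_of_forall_ballVerts (hG : G.Preconnected)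
    (h : ∀ n, (ballVerts G v n).Finite) (x : V) : (G.neighborSet x).Finite := by
  obtain ⟨n, hn⟩ := exists_mem_ballVerts v hG x
  exact (h (n + 1)).subset fun y hy => mem_ballVerts_succ_of_adj hn hy

end LocalToGlobal

theorem exists_connected_of_coherent {H : ℕ → RGClass.{u}} (hH : ∀ n, IsFiniteTreeBall n (H n))
    (hcoh : ∀ n, (H (n + 1)).ball n = H n) :
    ∃ (Y : Type u) (L : SimpleGraph Y) (w : Y), L.Connected ∧
      ∀ n, (rootedAt L w).ball n = H n := by
  choose K _ hK hKH using fun n => (hH n).exists_rep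
  choose f hroot hrange using fun n => exists_embedding_of_ball_eq (K := K n) (K' := K (n + 1))
    (n := n) (by rw [hKH, hKH, hcoh])
  obtain ⟨Y, L, g, hg, hsurj⟩ := exists_limit_of_embedding_succ f
  have root_eq (n : ℕ) : g n (K n).root = g 0 (K 0).root := by
    induction n with
    | zero => rfl
    | succ n ih => rw [← hroot, hg, ih]
  have reachable (y : Y) : L.Reachable (g 0 (K 0).root) y := by
    obtain ⟨n, x, rfl⟩ := hsurj y
    rw [← root_eq n]
    exact ((hK n).connected (K n).root x).map (g n).toHom
  refine ⟨Y, L, g 0 (K 0).root,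
    { preconnected := fun x y => (reachable x).symm.trans (reachable y)
      nonempty := ⟨g 0 (K 0).root⟩ }, fun n => ?_⟩
  have image := image_ballVerts_limit hroot (fun n => (hrange n).superset) hg hsurj n
  rw [← root_eq n, ← ball_rootedAt_eq_of_image (g n) image, ← (hH n).ball_eq, ← hKH n]
  rfl

theorem exists_lfRootedTree_of_coherent {H : ℕ → RGClass.{u}}
    (hH : ∀ n, IsFiniteTreeBall n (H n)) (hcoh : ∀ n, (H (n + 1)).ball n = H n) :
    ∃ x : LFRootedTree.{u}, ∀ n, x.1.ball n = H n := by
  obtain ⟨Y, L, w, hL, hball⟩ := exists_connected_of_coherent hH hcoh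
  have tree_ball (n : ℕ) : IsFiniteTreeBall n ((rootedAt L w).ball n) := hball n ▸ hH n
  exact ⟨⟨rootedAt L w, Y, L, w,
    ⟨hL, isAcyclic_of_forall_induce_ballVerts w hL.preconnected
      fun n => (tree_ball n).isAcyclic_induce⟩,
    finite_neighborSet_of_forall_ballVerts w hL.preconnected
      fun n => (tree_ball n).finite_ballVerts, rfl⟩, hball⟩

end LimitTree

section ProjectiveLimit

open ProbabilityTheory

theorem map_compProd_comap {α β γ : Type*} [MeasurableSpace α] [MeasurableSpace β]
    [MeasurableSpace γ] (μ : Measure α) [SFinite μ] {g : α → β} (hg : Measurable g)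
    (κ : Kernel β γ) [IsSFiniteKernel κ] :
    (μ ⊗ₘ κ.comap g hg).map (Prod.map g id) = μ.map g ⊗ₘ κ := by
  ext s hs
  have hm : Measurable (Prod.map g (id : γ → γ)) := by fun_prop
  rw [Measure.map_apply hm hs, Measure.compProd_apply (hm hs), Measure.compProd_apply hs,
    lintegral_map (Kernel.measurable_kernel_prodMk_left hs) hg]
  rfl

variable {X : ℕ → Type*} [∀ n, MeasurableSpace (X n)]

theorem map_eval_zero_trajMeasure (μ : Measure (X 0))
    (κ : ∀ n, Kernel (∀ i : Finset.Iic n, X i) (X (n + 1))) [∀ n, IsMarkovKernel (κ n)] :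
    (Kernel.trajMeasure μ κ).map (fun x => x 0) = μ := by
  let first : (∀ i : Finset.Iic 0, X i) → X 0 := fun y => y ⟨0, Finset.mem_Iic.2 le_rfl⟩
  have hfirst : Measurable first := measurable_pi_apply _
  have initial : (Kernel.trajMeasure μ κ).map (Preorder.frestrictLe 0) =
      μ.map (MeasurableEquiv.piUnique fun i : Finset.Iic 0 => X i).symm := by
    rw [Kernel.trajMeasure, Measure.map_comp _ _ (by fun_prop), Kernel.traj_map_frestrictLe,
      Kernel.partialTraj_self, Measure.id_comp]
    rfl
  calc (Kernel.trajMeasure μ κ).map (fun x => x 0)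
      = ((Kernel.trajMeasure μ κ).map (Preorder.frestrictLe 0)).map first :=
        (Measure.map_map hfirst (Preorder.measurable_frestrictLe 0)).symm
    _ = μ.map id := by
        rw [initial]
        exact Measure.map_map hfirst (MeasurableEquiv.measurable _)
    _ = μ := Measure.map_id

theorem exists_markovChain (μ : Measure (X 0)) [IsProbabilityMeasure μ]
    (κ : ∀ n, Kernel (X n) (X (n + 1))) [∀ n, IsMarkovKernel (κ n)] :
    ∃ P : Measure (∀ n, X n), IsProbabilityMeasure P ∧ P.map (fun x => x 0) = μ ∧
      ∀ n, P.map (fun x => (x n, x (n + 1))) = P.map (fun x => x n) ⊗ₘ κ n := by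
  have hlast (n : ℕ) : Measurable fun y : ∀ i : Finset.Iic n, X i =>
    y ⟨n, Finset.mem_Iic.2 le_rfl⟩ := measurable_pi_apply _
  let κ' (n : ℕ) : Kernel (∀ i : Finset.Iic n, X i) (X (n + 1)) := (κ n).comap _ (hlast n)
  have (n : ℕ) : IsMarkovKernel (κ' n) := inferInstanceAs (IsMarkovKernel ((κ n).comap _ _))
  refine ⟨Kernel.trajMeasure μ κ', inferInstance, map_eval_zero_trajMeasure μ κ', fun n => ?_⟩
  have history := congrArg (Measure.map (Prod.map (fun y => y ⟨n, Finset.mem_Iic.2 le_rfl⟩) id))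
    (Kernel.map_frestrictLe_trajMeasure_compProd_eq_map_trajMeasure (μ₀ := μ) (κ := κ') (a := n))
  rw [map_compProd_comap _ (hlast n), Measure.map_map (hlast n) (by fun_prop),
    Measure.map_map (by fun_prop) (by fun_prop)] at history
  exact history.symm

variable [∀ n, StandardBorelSpace (X n)] {f : ∀ n, X (n + 1) → X n}

/-- Conditionally on the first `n` coordinates, the next one has the conditional law of `p (n + 1)`
given `f n`, so that the limit is a Markov chain. -/
theorem exists_map_eval_eq_and_ae_coherent (hf : ∀ n, Measurable (f n))
    (p : ∀ n, Measure (X n))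
    [∀ n, IsProbabilityMeasure (p n)] (hp : ∀ n, (p (n + 1)).map (f n) = p n) :
    ∃ P : Measure (∀ n, X n), IsProbabilityMeasure P ∧ (∀ n, P.map (fun x => x n) = p n) ∧
      ∀ᵐ x ∂P, ∀ n, f n (x (n + 1)) = x n := by
  have (n : ℕ) : Nonempty (X n) := nonempty_of_isProbabilityMeasure (p n)
  obtain ⟨P, hP, hzero, hstep⟩ := exists_markovChain (p 0) fun n => condDistrib id (f n) (p (n + 1))
  have joint (n : ℕ) (h : P.map (fun x => x n) = p n) :
      P.map (fun x => (x n, x (n + 1))) = (p (n + 1)).map fun y => (f n y, y) := by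
    rw [hstep, h, ← hp n]
    exact compProd_map_condDistrib aemeasurable_id
  have marginal (n : ℕ) : P.map (fun x => x n) = p n := by
    induction n with
    | zero => exact hzero
    | succ n ih =>
      have h := congrArg (Measure.map Prod.snd) (joint n ih)
      rw [Measure.map_map measurable_snd (by fun_prop),
        Measure.map_map measurable_snd (by fun_prop)] at h
      exact h.trans Measure.map_id
  refine ⟨P, hP, marginal, ae_all_iff.2 fun n => ?_⟩
  suffices h : ∀ᵐ y ∂P.map (fun x => (x n, x (n + 1))), f n y.2 = y.1 from
    ae_of_ae_map (by fun_prop) h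
  rw [joint n (marginal n), ae_map_iff (by fun_prop)
    (measurableSet_eq_fun (by fun_prop) (by fun_prop))]
  exact .of_forall fun _ => rfl

theorem exists_projectiveLimit (hf : ∀ n, Measurable (f n)) (p : ∀ n, Measure (X n))
    [∀ n, IsProbabilityMeasure (p n)] (hp : ∀ n, (p (n + 1)).map (f n) = p n) :
    ∃ P : Measure {x : ∀ n, X n // ∀ n, f n (x (n + 1)) = x n}, IsProbabilityMeasure P ∧
      ∀ n, P.map (fun x => x.1 n) = p n := by
  obtain ⟨P, hP, hmarg, hcoh⟩ := exists_map_eval_eq_and_ae_coherent hf p hp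
  have hmeas : MeasurableSet {x : ∀ n, X n | ∀ n, f n (x (n + 1)) = x n} := by
    rw [Set.ofPred_forall]
    exact .iInter fun n => measurableSet_eq_fun (by fun_prop) (by fun_prop)
  have hval : (P.comap Subtype.val).map
      (Subtype.val : {x : ∀ n, X n // ∀ n, f n (x (n + 1)) = x n} → ∀ n, X n) = P :=
    (map_comap_subtype_coe hmeas P).trans (Measure.restrict_eq_self_of_ae_mem hcoh)
  refine ⟨P.comap Subtype.val, ?_, fun n => ?_⟩
  · rw [← Measure.isProbabilityMeasure_map_iff measurable_subtype_coe.aemeasurable, hval]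
    exact hP
  · rw [← hmarg n, ← hval, Measure.map_map (measurable_pi_apply n) measurable_subtype_coe, hval]
    rfl

end ProjectiveLimit

section RandomTree

instance : MeasurableSpace RGClass.{u} := ⊤

instance : DiscreteMeasurableSpace RGClass.{u} := ⟨fun _ => trivial⟩

theorem measurable_lfRootedTree_ball (r : ℕ) :
    Measurable fun x : LFRootedTree.{u} => x.1.ball r :=
  Measurable.of_comap_le (le_iSup (fun r : ℕ =>
    MeasurableSpace.comap (fun x : LFRootedTree.{u} => x.1.ball r) ⊤) r)

theorem measurable_lfRootedTree_of_ball {α : Type*} [MeasurableSpace α] {f : α → LFRootedTree.{u}}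
    (h : ∀ r, Measurable fun a => (f a).1.ball r) : Measurable f := by
  refine Measurable.of_le_map (iSup_le fun r => ?_)
  rintro _ ⟨A, -, rfl⟩
  exact h r (MeasurableSet.of_discrete (s := A))

theorem ext_of_map_ball {σ τ : ProbabilityMeasure LFRootedTree.{u}}
    (h : ∀ r, (σ : Measure LFRootedTree.{u}).map (fun x => x.1.ball r) =
      (τ : Measure LFRootedTree.{u}).map (fun x => x.1.ball r)) : σ = τ := by
  refine Subtype.ext (ext_of_generate_finite (μ := (σ : Measure LFRootedTree.{u}))
    (ν := (τ : Measure LFRootedTree.{u})) _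
    (MeasurableSpace.generateFrom_iUnion_measurableSet fun r : ℕ =>
      MeasurableSpace.comap (fun x : LFRootedTree.{u} => x.1.ball r) ⊤).symm
    (isPiSystem_iUnion_of_monotone _ (fun r =>
      @MeasurableSpace.isPiSystem_measurableSet _ (MeasurableSpace.comap _ ⊤)) ?_) ?_ (by simp))
  · rintro r r' hr _ ⟨A, -, rfl⟩
    refine ⟨RGClass.ball r ⁻¹' A, trivial, ?_⟩
    ext x
    simp only [Set.mem_preimage, RGClass.ball_ball hr]
  · intro S hS
    obtain ⟨r, A, -, rfl⟩ := Set.mem_iUnion.1 hS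
    have hA := congrArg (fun μ => μ A) (h r)
    rwa [Measure.map_apply (measurable_lfRootedTree_ball r) .of_discrete,
      Measure.map_apply (measurable_lfRootedTree_ball r) .of_discrete] at hA

theorem countable_finite_rootedGraph :
    {H : RGClass.{u} | ∃ K : RootedGraph.{u}, Finite K.V ∧ Quotient.mk _ K = H}.Countable := by
  refine (Set.countable_range fun x : Σ n : ℕ, SimpleGraph (Fin n) × Fin n =>
    rootedAt (x.2.1.comap ULift.down) (ULift.up.{u} x.2.2)).mono ?_
  rintro _ ⟨⟨V, G, v⟩, hV, rfl⟩
  let e : V ≃ Fin (Nat.card V) := Finite.equivFin V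
  refine ⟨⟨Nat.card V, G.comap e.symm, e v⟩, Quotient.sound ⟨⟨Equiv.ulift.trans e.symm, ?_⟩, ?_⟩⟩
  · rfl
  · exact e.symm_apply_apply v

theorem IsFiniteTreeBall.ball {r : ℕ} {H : RGClass.{u}} (h : IsFiniteTreeBall (r + 1) H) :
    IsFiniteTreeBall r (H.ball r) := by
  obtain ⟨V, T, v, hV, hT, rfl⟩ := h
  exact ⟨V, T, v, hV, hT, RGClass.ball_ball r.le_succ _⟩

/-- The countable space of `r`-balls in finite trees. -/
abbrev FiniteTreeBall (r : ℕ) : Type (u + 1) := {H : RGClass.{u} | IsFiniteTreeBall r H}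

namespace FiniteTreeBall

instance (r : ℕ) : Countable (FiniteTreeBall.{u} r) :=
  (countable_finite_rootedGraph.mono fun _ h =>
    let ⟨K, hK, _, hKH⟩ := IsFiniteTreeBall.exists_rep h
    ⟨K, hK, hKH⟩).to_subtype

/-- The concentric ball of the next smaller radius, the bonding map of the projective system. -/
def shrink {r : ℕ} (H : FiniteTreeBall.{u} (r + 1)) : FiniteTreeBall.{u} r :=
  ⟨H.1.ball r, H.2.ball⟩

theorem exists_measurable_limit :
    ∃ Φ : {x : ∀ r, FiniteTreeBall.{u} r // ∀ r, (x (r + 1)).shrink = x r} → LFRootedTree.{u},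
      Measurable Φ ∧ ∀ x r, (Φ x).1.ball r = (x.1 r).1 := by
  choose Φ hΦ using fun x : {x : ∀ r, FiniteTreeBall.{u} r // ∀ r, (x (r + 1)).shrink = x r} =>
    exists_lfRootedTree_of_coherent (fun r => (x.1 r).2) fun r => congrArg Subtype.val (x.2 r)
  refine ⟨Φ, measurable_lfRootedTree_of_ball fun r => ?_, hΦ⟩
  simp only [hΦ]
  exact measurable_subtype_coe.comp ((measurable_pi_apply r).comp measurable_subtype_coe)

theorem exists_map_val_eq (ν : ℕ → Measure RGClass.{u}) [∀ r, IsProbabilityMeasure (ν r)]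
    (hν : ∀ r, ∀ᵐ H ∂ν r, IsFiniteTreeBall r H)
    (hcons : ∀ r, (ν (r + 1)).map (RGClass.ball r) = ν r) :
    ∃ p : ∀ r, Measure (FiniteTreeBall.{u} r), (∀ r, IsProbabilityMeasure (p r)) ∧
      (∀ r, (p r).map Subtype.val = ν r) ∧ ∀ r, (p (r + 1)).map shrink = p r := by
  have embedding (r : ℕ) :
      MeasurableEmbedding (Subtype.val : FiniteTreeBall.{u} r → RGClass.{u}) :=
    .subtype_coe .of_discrete
  have map_val (r : ℕ) : ((ν r).comap Subtype.val).map
      (Subtype.val : FiniteTreeBall.{u} r → RGClass.{u}) = ν r :=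
    (map_comap_subtype_coe .of_discrete (ν r)).trans (Measure.restrict_eq_self_of_ae_mem (hν r))
  refine ⟨fun r => (ν r).comap Subtype.val, fun r => (embedding r).isProbabilityMeasure_comap
    ((hν r).mono fun H h => ⟨⟨H, h⟩, rfl⟩), map_val, fun r => (embedding r).map_injective ?_⟩
  calc (((ν (r + 1)).comap Subtype.val).map shrink).map Subtype.val
      = (((ν (r + 1)).comap Subtype.val).map
          (Subtype.val : FiniteTreeBall.{u} (r + 1) → RGClass.{u})).map (RGClass.ball r) := by
        rw [Measure.map_map .of_discrete .of_discrete, Measure.map_map .of_discrete .of_discrete]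
        rfl
    _ = ((ν r).comap Subtype.val).map Subtype.val := by rw [map_val, hcons, map_val]

end FiniteTreeBall

theorem exists_map_ball_eq (ν : ℕ → Measure RGClass.{u}) [∀ r, IsProbabilityMeasure (ν r)]
    (hν : ∀ r, ∀ᵐ H ∂ν r, IsFiniteTreeBall r H)
    (hcons : ∀ r, (ν (r + 1)).map (RGClass.ball r) = ν r) :
    ∃ σ : ProbabilityMeasure LFRootedTree.{u},
      ∀ r, (σ : Measure LFRootedTree.{u}).map (fun x => x.1.ball r) = ν r := by
  obtain ⟨p, hp, hval, hshrink⟩ := FiniteTreeBall.exists_map_val_eq ν hν hcons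
  obtain ⟨P, hP, hmarg⟩ := exists_projectiveLimit (fun _ => .of_discrete) p hshrink
  obtain ⟨Φ, hΦm, hΦ⟩ := FiniteTreeBall.exists_measurable_limit.{u}
  refine ⟨⟨P.map Φ, Measure.isProbabilityMeasure_map hΦm.aemeasurable⟩, fun r => ?_⟩
  rw [← hval r, ← hmarg r, Measure.map_map measurable_subtype_coe
    ((measurable_pi_apply r).comp measurable_subtype_coe)]
  exact (Measure.map_map (measurable_lfRootedTree_ball r) hΦm).trans
    (congrArg (P.map ·) (funext fun x => hΦ x r))

end RandomTree

section Scheffe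

variable {ι : Type*} {a : ℕ → ι → ℝ} {s : ι → ℝ} {c : ℝ}

theorem tendsto_tsum_abs_sub_of_hasSum (ha : ∀ n i, 0 ≤ a n i) (hsum : ∀ n, HasSum (a n) c)
    (hs : HasSum s c) (h : ∀ i, Tendsto (fun n => a n i) atTop (𝓝 (s i))) :
    Tendsto (fun n => ∑' i, |a n i - s i|) atTop (𝓝 0) := by
  have hs0 (i : ι) : 0 ≤ s i := ge_of_tendsto' (h i) fun n => ha n i
  have hmin (n : ℕ) (i : ι) : ‖min (a n i) (s i)‖ ≤ s i :=
    (Real.norm_of_nonneg (le_min (ha n i) (hs0 i))).trans_le (min_le_right _ _)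
  have overlap : Tendsto (fun n => ∑' i, min (a n i) (s i)) atTop (𝓝 c) := by
    rw [← hs.tsum_eq]
    refine tendsto_tsum_of_dominated_convergence hs.summable (fun i => ?_)
      (.of_forall fun n => hmin n)
    simpa only [min_self] using (h i).min (tendsto_const_nhds (x := s i))
  have abs_eq (x y : ℝ) : |x - y| = x + y - 2 * min x y := by
    linarith [max_sub_min_eq_abs' x y, min_add_max x y]
  have tsum_eq (n : ℕ) : ∑' i, |a n i - s i| = c + c - 2 * ∑' i, min (a n i) (s i) := by
    simp_rw [abs_eq]
    exact (((hsum n).add hs).sub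
      ((Summable.of_norm_bounded hs.summable (hmin n)).hasSum.mul_left 2)).tsum_eq
  simp_rw [tsum_eq]
  simpa [two_mul] using (overlap.const_mul 2).const_sub (c + c)

theorem tendsto_tsum_mul_of_hasSum (ha : ∀ n i, 0 ≤ a n i) (hsum : ∀ n, HasSum (a n) c)
    (hs : HasSum s c) (h : ∀ i, Tendsto (fun n => a n i) atTop (𝓝 (s i))) {F : ι → ℝ} {C : ℝ}
    (hF : ∀ i, |F i| ≤ C) :
    Tendsto (fun n => ∑' i, a n i * F i) atTop (𝓝 (∑' i, s i * F i)) := by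
  have summable_mul {b : ι → ℝ} (hb : Summable b) : Summable fun i => b i * F i :=
    .of_norm_bounded (hb.abs.mul_right C) fun i => by
      rw [Real.norm_eq_abs, abs_mul]
      exact mul_le_mul_of_nonneg_left (hF i) (abs_nonneg _)
  have hlim := (tendsto_tsum_abs_sub_of_hasSum ha hsum hs h).mul_const C
  rw [zero_mul] at hlim
  rw [tendsto_iff_norm_sub_tendsto_zero]
  refine squeeze_zero (fun n => norm_nonneg _) (fun n => ?_) hlim
  rw [← (summable_mul (hsum n).summable).tsum_sub (summable_mul hs.summable)]
  refine tsum_of_norm_bounded (((hsum n).summable.sub hs.summable).abs.hasSum.mul_right C)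
    fun i => ?_
  rw [← sub_mul, Real.norm_eq_abs, abs_mul]
  exact mul_le_mul_of_nonneg_left (hF i) (abs_nonneg _)

end Scheffe

theorem eq_toMeasure_of_measure_singleton {α : Type*} [MeasurableSpace α]
    [MeasurableSingletonClass α] {μ : Measure α} [IsProbabilityMeasure μ] {p : PMF α}
    (h : ∀ a, μ {a} = p a) : μ = p.toMeasure := by
  refine (Measure.eq_of_le_of_isProbabilityMeasure (Measure.le_iff.2 fun A _ => ?_)).symm
  calc p.toMeasure A
      = ∑' a : A, μ {a.1} := by
        rw [PMF.toMeasure_apply_eq_tsum, ← tsum_subtype]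
        simp only [h]
    _ ≤ μ (⋃ a : A, {a.1}) := tsum_meas_le_meas_iUnion_of_disjoint μ
        (fun a => measurableSet_singleton a.1)
        fun a b hab => Set.disjoint_singleton.2 (Subtype.coe_injective.ne hab)
    _ = μ A := by rw [Set.iUnion_of_singleton_coe]

section BallFrequencies

variable {V : Type u} (G : SimpleGraph V) (r : ℕ)

theorem ballFreq_nonneg (H : RGClass.{u}) : 0 ≤ ballFreq G r H := by
  unfold ballFreq
  positivity

theorem hasSum_ballFreq_mul [Fintype V] (F : RGClass.{u} → ℝ) :
    HasSum (fun H => ballFreq G r H * F H)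
      ((∑ v, F ((rootedAt G v).ball r)) / Nat.card V) := by
  classical
  have ballFreq_eq (H : RGClass.{u}) : ballFreq G r H * F H =
      ∑ v, if H = (rootedAt G v).ball r then F ((rootedAt G v).ball r) / Nat.card V else 0 := by
    calc ballFreq G r H * F H
        = ∑ v with (rootedAt G v).ball r = H, F H / Nat.card V := by
          rw [ballFreq, Set.ncard_eq_toFinset_card', Finset.sum_const, nsmul_eq_mul,
            Set.toFinset_ofPred]
          ring
      _ = _ := by
          rw [Finset.sum_filter]
          refine Finset.sum_congr rfl fun v _ => ?_
          simp only [eq_comm]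
          split_ifs with h <;> simp [h]
  simp_rw [ballFreq_eq, Finset.sum_div]
  exact hasSum_sum fun v _ => hasSum_ite_eq _ _

theorem hasSum_ballFreq [Finite V] [Nonempty V] : HasSum (ballFreq G r) 1 := by
  have := Fintype.ofFinite V
  simpa using hasSum_ballFreq_mul G r fun _ => 1

end BallFrequencies

namespace BSConvergesTo

variable {V : ℕ → Type u} {T : ∀ n, SimpleGraph (V n)} {s : ℕ → RGClass.{u} → ℝ}

theorem nonneg (hs : BSConvergesTo T s) (r : ℕ) (H : RGClass.{u}) : 0 ≤ s r H :=
  ge_of_tendsto' (hs.1 r H) fun n => ballFreq_nonneg (T n) r H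

/-- The limit statistics `s r` as a probability mass function. -/
noncomputable def ballLaw (hs : BSConvergesTo T s) (r : ℕ) : PMF RGClass.{u} :=
  ⟨fun H => ENNReal.ofReal (s r H), by
    have h := ENNReal.ofReal_tsum_of_nonneg (hs.nonneg r) (hs.2 r).summable
    rw [(hs.2 r).tsum_eq, ENNReal.ofReal_one] at h
    exact h ▸ ENNReal.summable.hasSum⟩

theorem ballLaw_apply (hs : BSConvergesTo T s) (r : ℕ) (H : RGClass.{u}) :
    hs.ballLaw r H = ENNReal.ofReal (s r H) := rfl

theorem integral_ballLaw (hs : BSConvergesTo T s) (r : ℕ) {F : RGClass.{u} → ℝ} {C : ℝ}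
    (hF : ∀ H, |F H| ≤ C) : ∫ H, F H ∂(hs.ballLaw r).toMeasure = ∑' H, s r H * F H := by
  rw [PMF.integral_eq_tsum _ _ (.of_bound Measurable.of_discrete.aestronglyMeasurable C
    (.of_forall hF))]
  simp only [ballLaw_apply, ENNReal.toReal_ofReal (hs.nonneg r _), smul_eq_mul]

theorem hasBallStatistics_iff_map_ball (hs : BSConvergesTo T s)
    {σ : ProbabilityMeasure LFRootedTree.{u}} : HasBallStatistics σ s ↔
      ∀ r, (σ : Measure LFRootedTree.{u}).map (fun x => x.1.ball r) = (hs.ballLaw r).toMeasure := by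
  have hmeas (r : ℕ) := measurable_lfRootedTree_ball.{u} r
  refine ⟨fun h r => ?_, fun h r H => ?_⟩
  · have := Measure.isProbabilityMeasure_map (μ := (σ : Measure LFRootedTree.{u}))
      (hmeas r).aemeasurable
    refine eq_toMeasure_of_measure_singleton fun H => ?_
    rw [Measure.map_apply (hmeas r) (measurableSet_singleton H), ballLaw_apply, ← h r H,
      ofReal_measureReal]
    rfl
  · calc (σ : Measure LFRootedTree.{u}).real {x | x.1.ball r = H}
        = ((σ : Measure LFRootedTree.{u}).map (fun x => x.1.ball r)).real {H} :=
          (map_measureReal_apply (hmeas r) (measurableSet_singleton H)).symm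
      _ = s r H := by
          rw [h r, Measure.real, PMF.toMeasure_apply_singleton _ _ (measurableSet_singleton H),
            ballLaw_apply, ENNReal.toReal_ofReal (hs.nonneg r H)]

section Average

variable [∀ n, Fintype (V n)] [∀ n, Nonempty (V n)]

theorem tendsto_average (hs : BSConvergesTo T s) (r : ℕ) {F : RGClass.{u} → ℝ} {C : ℝ}
    (hF : ∀ H, |F H| ≤ C) :
    Tendsto (fun n => (∑ v, F ((rootedAt (T n) v).ball r)) / Nat.card (V n)) atTop
      (𝓝 (∫ H, F H ∂(hs.ballLaw r).toMeasure)) := by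
  simp_rw [hs.integral_ballLaw r hF, ← (hasSum_ballFreq_mul (T _) r F).tsum_eq]
  exact tendsto_tsum_mul_of_hasSum (fun n => ballFreq_nonneg (T n) r)
    (fun n => hasSum_ballFreq (T n) r) (hs.2 r) (hs.1 r) hF

theorem tendsto_average_indicator (hs : BSConvergesTo T s) (r : ℕ) (A : Set RGClass.{u}) :
    Tendsto (fun n => (∑ v, A.indicator 1 ((rootedAt (T n) v).ball r)) / (Nat.card (V n) : ℝ)) atTop
      (𝓝 ((hs.ballLaw r).toMeasure.real A)) := by
  classical
  rw [← integral_indicator_one .of_discrete]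
  refine hs.tendsto_average r (C := 1) fun H => ?_
  rw [Set.indicator_apply]
  split_ifs <;> simp

end Average

variable [∀ n, Finite (V n)]

theorem map_ball_ballLaw [∀ n, Nonempty (V n)] (hs : BSConvergesTo T s) (r : ℕ) :
    (hs.ballLaw (r + 1)).toMeasure.map (RGClass.ball r) = (hs.ballLaw r).toMeasure := by
  have (n : ℕ) := Fintype.ofFinite (V n)
  ext A hA
  rw [Measure.map_apply .of_discrete hA, ← measureReal_eq_measureReal_iff]
  refine tendsto_nhds_unique (hs.tendsto_average_indicator (r + 1) (RGClass.ball r ⁻¹' A))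
    ((hs.tendsto_average_indicator r A).congr fun n => ?_)
  refine congrArg (· / (Nat.card (V n) : ℝ)) (Finset.sum_congr rfl fun v _ => ?_)
  rw [← RGClass.ball_ball r.le_succ]
  rfl

theorem ae_isFiniteTreeBall (hs : BSConvergesTo T s) (hT : ∀ n, (T n).IsTree) (r : ℕ) :
    ∀ᵐ H ∂(hs.ballLaw r).toMeasure, IsFiniteTreeBall r H := by
  have (n : ℕ) := Fintype.ofFinite (V n)
  have (n : ℕ) := (hT n).connected.nonempty
  rw [ae_iff, ← measureReal_eq_zero_iff]
  refine tendsto_nhds_unique (hs.tendsto_average_indicator r _)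
    (tendsto_const_nhds.congr fun n => ?_)
  have isFiniteTreeBall (v : V n) : IsFiniteTreeBall r ((rootedAt (T n) v).ball r) :=
    ⟨V n, T n, v, inferInstance, hT n, rfl⟩
  simp [isFiniteTreeBall]

theorem existsUnique_hasBallStatistics (hs : BSConvergesTo T s) (hT : ∀ n, (T n).IsTree) :
    ∃! σ : ProbabilityMeasure LFRootedTree.{u}, HasBallStatistics σ s := by
  have (n : ℕ) := (hT n).connected.nonempty
  obtain ⟨σ, hσ⟩ := exists_map_ball_eq (fun r => (hs.ballLaw r).toMeasure)
    (hs.ae_isFiniteTreeBall hT) hs.map_ball_ballLaw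
  refine ⟨σ, hs.hasBallStatistics_iff_map_ball.2 hσ, fun τ hτ => ext_of_map_ball fun r => ?_⟩
  rw [hs.hasBallStatistics_iff_map_ball.1 hτ, hσ]

end BSConvergesTo

section Entropy

/-- The approximation of `log (1 + 1 / M)` obtained by capping `M` at `r + 1`: this value depends
only on the `r`-ball around the root. -/
noncomputable def truncEntropy (r : ℕ) (H : RGClass.{u}) : ℝ :=
  logOneAddInv (min H.minSubtrees (r + 1))

theorem abs_truncEntropy_le (r : ℕ) (H : RGClass.{u}) : |truncEntropy r H| ≤ 1 := by
  rw [truncEntropy, abs_of_nonneg (logOneAddInv_nonneg _)]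
  exact logOneAddInv_le_one _

theorem abs_truncEntropy_ball_sub_le {V : Type u} {T : SimpleGraph V} (hT : T.IsAcyclic) (v : V)
    {r : ℕ} (hr : 1 ≤ r) :
    |truncEntropy r ((rootedAt T v).ball r) - logOneAddInv (minSubtreesAt T v)| ≤
      ((r : ℝ) + 1)⁻¹ := by
  rw [truncEntropy, min_minSubtrees_ball hT v hr]
  exact abs_logOneAddInv_min_sub_le _ r

theorem tendsto_inv_natCast_add_one : Tendsto (fun r : ℕ => ((r : ℝ) + 1)⁻¹) atTop (𝓝 0) := by
  simpa only [one_div] using tendsto_one_div_add_atTop_nhds_zero_nat (𝕜 := ℝ)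

theorem tendsto_truncEntropy_ball (x : LFRootedTree.{u}) :
    Tendsto (fun r => truncEntropy r (x.1.ball r)) atTop (𝓝 (entropyFun x)) := by
  obtain ⟨x, V, T, v, hT, -, rfl⟩ := x
  rw [tendsto_iff_norm_sub_tendsto_zero]
  exact squeeze_zero' (.of_forall fun _ => norm_nonneg _) ((eventually_ge_atTop 1).mono fun _ hr =>
    abs_truncEntropy_ball_sub_le hT.isAcyclic v hr) tendsto_inv_natCast_add_one

theorem measurable_truncEntropy_ball (r : ℕ) :
    Measurable fun x : LFRootedTree.{u} => truncEntropy r (x.1.ball r) :=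
  (Measurable.of_discrete (f := truncEntropy r)).comp (measurable_lfRootedTree_ball r)

variable (σ : Measure LFRootedTree.{u}) [IsFiniteMeasure σ]

theorem integrable_entropyFun : Integrable entropyFun σ := by
  have measurable_entropyFun : Measurable entropyFun.{u} :=
    measurable_of_tendsto_metrizable measurable_truncEntropy_ball
      (tendsto_pi_nhds.2 tendsto_truncEntropy_ball)
  exact .of_bound measurable_entropyFun.aestronglyMeasurable 1 (.of_forall fun x =>
    (abs_of_nonneg (logOneAddInv_nonneg x.1.minSubtrees)).trans_le (logOneAddInv_le_one _))

theorem tendsto_integral_truncEntropy_ball :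
    Tendsto (fun r => ∫ x, truncEntropy r (x.1.ball r) ∂σ) atTop (𝓝 (∫ x, entropyFun x ∂σ)) :=
  tendsto_integral_of_dominated_convergence (fun _ => 1)
    (fun r => (measurable_truncEntropy_ball r).aestronglyMeasurable) (integrable_const 1)
    (fun r => .of_forall fun _ => abs_truncEntropy_le r _) (.of_forall tendsto_truncEntropy_ball)

end Entropy

section Averages

theorem abs_sum_div_card_sub_le {ι : Type*} [Fintype ι] {f g : ι → ℝ} {c : ℝ} (hc : 0 ≤ c)
    (h : ∀ i, |f i - g i| ≤ c) :
    |(∑ i, f i) / Nat.card ι - (∑ i, g i) / Nat.card ι| ≤ c := by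
  rw [← sub_div, ← Finset.sum_sub_distrib, abs_div, Nat.abs_cast]
  refine div_le_of_le_mul₀ (Nat.cast_nonneg _) hc ((Finset.abs_sum_le_sum_abs _ _).trans ?_)
  calc ∑ i, |f i - g i| ≤ ∑ _i : ι, c := Finset.sum_le_sum fun i _ => h i
    _ = c * Nat.card ι := by simp [mul_comm]

theorem tendstoUniformly_average_truncEntropy {V : ℕ → Type u} [∀ n, Fintype (V n)]
    {T : ∀ n, SimpleGraph (V n)} (hT : ∀ n, (T n).IsAcyclic) :
    TendstoUniformly
      (fun r n => (∑ v, truncEntropy r ((rootedAt (T n) v).ball r)) / (Nat.card (V n) : ℝ))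
      (fun n => (∑ v, logOneAddInv (minSubtreesAt (T n) v)) / (Nat.card (V n) : ℝ)) atTop := by
  refine Metric.tendstoUniformly_iff.2 fun ε hε => ?_
  filter_upwards [eventually_ge_atTop 1, tendsto_inv_natCast_add_one.eventually_lt_const hε]
    with r hr hrε n
  rw [dist_comm, Real.dist_eq]
  exact (abs_sum_div_card_sub_le (by positivity) fun v =>
    abs_truncEntropy_ball_sub_le (hT n) v hr).trans_lt hrε

theorem BSConvergesTo.tendsto_average_logOneAddInv {V : ℕ → Type u} [∀ n, Fintype (V n)]
    {T : ∀ n, SimpleGraph (V n)} (hT : ∀ n, (T n).IsTree) {s : ℕ → RGClass.{u} → ℝ}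
    (hs : BSConvergesTo T s) {σ : ProbabilityMeasure LFRootedTree.{u}}
    (hσ : HasBallStatistics σ s) :
    Tendsto (fun n => (∑ v, logOneAddInv (minSubtreesAt (T n) v)) / (Nat.card (V n) : ℝ)) atTop
      (𝓝 (∫ x, entropyFun x ∂(σ : Measure LFRootedTree.{u}))) := by
  have (n : ℕ) : Nonempty (V n) := (hT n).connected.nonempty
  refine (tendstoUniformly_average_truncEntropy
    fun n => (hT n).isAcyclic).tendsto_of_eventually_tendsto (.of_forall fun r => ?_)
    (tendsto_integral_truncEntropy_ball (σ : Measure LFRootedTree.{u}))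
  rw [← integral_map (measurable_lfRootedTree_ball r).aemeasurable
    Measurable.of_discrete.aestronglyMeasurable, hs.hasBallStatistics_iff_map_ball.1 hσ]
  exact hs.tendsto_average r (abs_truncEntropy_le r)

theorem tendsto_log_add_one_div :
    Tendsto (fun m : ℕ => (Real.log m + 1) / (m : ℝ)) atTop (𝓝 0) := by
  have hlog := Real.isLittleO_log_id_atTop.tendsto_div_nhds_zero.comp tendsto_natCast_atTop_atTop
  simpa [add_div, Function.comp_def] using
    hlog.add (tendsto_one_div_atTop_nhds_zero_nat (𝕜 := ℝ))

theorem tendsto_log_numSubtrees_div_sub_average {V : ℕ → Type u} [∀ n, Fintype (V n)]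
    {T : ∀ n, SimpleGraph (V n)} (hT : ∀ n, (T n).IsTree)
    (hcard : Tendsto (fun n => Nat.card (V n)) atTop atTop) :
    Tendsto (fun n => Real.log (numSubtrees (T n)) / (Nat.card (V n) : ℝ) -
      (∑ v, logOneAddInv (minSubtreesAt (T n) v)) / (Nat.card (V n) : ℝ)) atTop (𝓝 0) := by
  refine squeeze_zero_norm (fun n => ?_) (tendsto_log_add_one_div.comp hcard)
  rw [← sub_div, norm_div, Real.norm_natCast, Real.norm_eq_abs]
  exact div_le_div_of_nonneg_right (abs_log_numSubtrees_sub_sum_le (hT n)) (Nat.cast_nonneg _)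

end Averages

theorem theorem1 {V : ℕ → Type u} [∀ n, Finite (V n)] (T : ∀ n, SimpleGraph (V n))
    (hT : ∀ n, (T n).IsTree) (hcard : Tendsto (fun n => Nat.card (V n)) atTop atTop)
    (s : ℕ → RGClass.{u} → ℝ) (hs : BSConvergesTo T s) :
    (∃! σ : ProbabilityMeasure LFRootedTree.{u}, HasBallStatistics σ s) ∧
    ∀ σ : ProbabilityMeasure LFRootedTree.{u}, HasBallStatistics σ s →
      Integrable entropyFun (σ : Measure LFRootedTree.{u}) ∧
      Tendsto (fun n => Real.log (numSubtrees (T n)) / (Nat.card (V n) : ℝ)) atTop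
        (𝓝 (∫ x, entropyFun x ∂(σ : Measure LFRootedTree.{u}))) := by
  have (n : ℕ) : Fintype (V n) := Fintype.ofFinite (V n)
  refine ⟨hs.existsUnique_hasBallStatistics hT, fun σ hσ => ⟨integrable_entropyFun _, ?_⟩⟩
  simpa only [sub_add_cancel, zero_add] using
    (tendsto_log_numSubtrees_div_sub_average hT hcard).add (hs.tendsto_average_logOneAddInv hT hσ)
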